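/- Let $\mathbf C$ be a (strict) cubical $\omega$-category with connections in the sense of Al-Agl, Brown and Steiner, with face maps $\partial_i^\alpha:\mathbf C_n\to\mathbf C_{n-1}$, degeneracies $\epsilon_i:\mathbf C_{n-1}\to\mathbf C_{n}$, connections $\Gamma_i^\alpha:\mathbf C_n\to\mathbf C_{n+1}$ ($1\le i\le n$, $\alpha=\pm$), and compositions $A\star_i B$, defined for $A,B\in\mathbf C_n$, $1\le i\le n$, exactly when $\partial_i^+A=\partial_i^-B$. The conventions for connections are $\partial_i^\alpha\Gamma_i^\alpha A=\partial_{i+1}^\alpha\Gamma_i^\alpha A=A$ and $\partial_i^\alpha\Gamma_i^{-\alpha}A=\partial_{i+1}^\alpha\Gamma_i^{-\alpha}A=\epsilon_i\partial_i^\alpha A$. For $A\in\mathbf C_n$ and $1\le i<n$ put $\psi_iA=\Gamma_i^+\partial_{i+1}^-A\star_{i+1}A\star_{i+1}\Gamma_i^-\partial_{i+1}^+A$. An $n$-cell $A$ ($n\geq 1$) is called *invertible* if $X=\psi_1\cdots\psi_{n-1}A$ has an inverse for $\star_1$, i.e. there is $Y\in\mathbf C_n$ with $X\star_1Y=\epsilon_1\partial_1^-X$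 and $Y\star_1X=\epsilon_1\partial_1^+X$. $\mathbf C$ is a *cubical $(\omega,1)$-category* if every $n$-cell with $n>1$ is invertible. For $1\le i<n$ and $A,B\in\mathbf C_n$, the cell $B$ is a *$T_i$-inverse* of $A$ if $\partial_i^\alpha A=\partial_{i+1}^\alpha B$ and $\partial_{i+1}^\alpha A=\partial_i^\alpha B$ for $\alpha=\pm$, and $$(\Gamma_i^+\partial_{i+1}^-A\star_iB)\star_{i+1}(A\star_i\Gamma_i^-\partial_i^+A)=\Gamma_i^-\partial_i^-A\star_i\Gamma_i^+\partial_{i+1}^+A,$$ $$(\Gamma_i^+\partial_{i+1}^-B\star_iA)\star_{i+1}(B\star_i\Gamma_i^-\partial_i^+B)=\Gamma_i^-\partial_i^-B\star_i\Gamma_i^+\partial_{i+1}^+B.$$ **Proposition.** Let $\mathbf C$ be a cubical $(\omega,1)$-category. For all $1\le i<n$, every $A\in\mathbf C_n$ has exactly one $T_i$-inverse, denoted $T_iA$. The resulting total maps $T_i:\mathbf C_n\to\mathbf C_n$ make $\mathbf C$ a symmetric cubical $\omega$-category. That is, whenever the indices are such that all operations written are defined: 1. (faces) $\partial_j^\alpha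 T_jA=\partial_{j+1}^\alpha A$ and $\partial_{j+1}^\alpha T_jA=\partial_j^\alpha A$; moreover $\partial_i^\alpha T_jA=T_{j-1}\partial_i^\alpha A$ if $i<j$, and $\partial_i^\alpha T_jA=T_j\partial_i^\alpha A$ if $i>j+1$. 2. (degeneracies) $T_j\epsilon_jA=\epsilon_{j+1}A$ and $T_{j-1}\epsilon_jA=\epsilon_{j-1}A$; moreover $T_i\epsilon_jA=\epsilon_jT_iA$ if $i<j-1$, and $T_{i+1}\epsilon_jA=\epsilon_jT_iA$ if $i\ge j$. 3. (connections) $T_j\Gamma_j^\alpha A=\Gamma_j^\alpha A$; $T_i\Gamma_j^\alpha A=\Gamma_j^\alpha T_iA$ if $i<j-1$; $T_{i+1}\Gamma_j^\alpha A=\Gamma_j^\alpha T_iA$ if $i>j$; $T_{i+1}\Gamma_i^\alpha T_iA=T_i\Gamma_{i+1}^\alpha A$ and $T_i\Gamma_{i+1}^\alpha T_iA=T_{i+1}\Gamma_i^\alpha A$. 4. (compositions) if $\partial_j^+A=\partial_j^-B$, then $T_i(A\star_jB)$ equals $T_iA\star_{i+1}T_iB$ if $j=i$, equals $T_iA\star_iT_iB$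 if $j=i+1$, and equals $T_iA\star_jT_iB$ otherwise. 5. (symmetric group relations) $T_iT_iA=A$; $T_iT_{i+1}T_iA=T_{i+1}T_iT_{i+1}A$; $T_iT_jA=T_jT_iA$ if $|i-j|\ge2$. -/

import Mathlib

universe u

/-- A cubical set with connections. `cell n` is the set of `n`-cells. Directions are numbered from `1`
as usual; `face`, `deg`, `conn` are total in their index, and only the values at the legal indices
(`1 ≤ i ≤ n + 1` each time) are subject to axioms or ever used.
Signs are Booleans: `false` is `-` and `true` is `+`.
`face α i` is `∂_i^α`, `deg i` is the degeneracy `ε_i`, `conn α i` is the connection `Γ_i^α`. -/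
structure CubicalSet where
  cell : ℕ → Type u
  face : ∀ {n : ℕ}, Bool → ℕ → cell (n + 1) → cell n
  deg : ∀ {n : ℕ}, ℕ → cell n → cell (n + 1)
  conn : ∀ {n : ℕ}, Bool → ℕ → cell (n + 1) → cell (n + 2)
  face_face : ∀ {n : ℕ} (α β : Bool) (i j : ℕ) (A : cell (n + 2)), 1 ≤ i → i ≤ j → j ≤ n + 1 →
    face α j (face β i A) = face β i (face α (j + 1) A)
  face_deg_self : ∀ {n : ℕ} (α : Bool) (i : ℕ) (A : cell n), 1 ≤ i → i ≤ n + 1 →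
    face α i (deg i A) = A
  face_deg_lt : ∀ {n : ℕ} (α : Bool) (i j : ℕ) (A : cell (n + 1)), 1 ≤ i → i ≤ j → j ≤ n + 1 →
    face α i (deg (j + 1) A) = deg j (face α i A)
  face_deg_gt : ∀ {n : ℕ} (α : Bool) (i j : ℕ) (A : cell (n + 1)), 1 ≤ j → j ≤ i → i ≤ n + 1 →
    face α (i + 1) (deg j A) = deg j (face α i A)
  face_conn_same : ∀ {n : ℕ} (α : Bool) (i : ℕ) (A : cell (n + 1)), 1 ≤ i → i ≤ n + 1 →
    face α i (conn α i A) = A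
  face_conn_same_succ : ∀ {n : ℕ} (α : Bool) (i : ℕ) (A : cell (n + 1)), 1 ≤ i → i ≤ n + 1 →
    face α (i + 1) (conn α i A) = A
  face_conn_opp : ∀ {n : ℕ} (α : Bool) (i : ℕ) (A : cell (n + 1)), 1 ≤ i → i ≤ n + 1 →
    face α i (conn (!α) i A) = deg i (face α i A)
  face_conn_opp_succ : ∀ {n : ℕ} (α : Bool) (i : ℕ) (A : cell (n + 1)), 1 ≤ i → i ≤ n + 1 →
    face α (i + 1) (conn (!α) i A) = deg i (face α i A)
  face_conn_lt : ∀ {n : ℕ} (α β : Bool) (i j : ℕ) (A : cell (n + 2)), 1 ≤ i → i ≤ j → j ≤ n + 1 →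
    face α i (conn β (j + 1) A) = conn β j (face α i A)
  face_conn_gt : ∀ {n : ℕ} (α β : Bool) (i j : ℕ) (A : cell (n + 2)), 1 ≤ j → j < i → i ≤ n + 2 →
    face α (i + 1) (conn β j A) = conn β j (face α i A)
  deg_deg : ∀ {n : ℕ} (i j : ℕ) (A : cell n), 1 ≤ i → i ≤ j → j ≤ n + 1 →
    deg i (deg j A) = deg (j + 1) (deg i A)
  conn_conn_lt : ∀ {n : ℕ} (α β : Bool) (i j : ℕ) (A : cell (n + 1)), 1 ≤ i → i < j → j ≤ n + 1 →
    conn α i (conn β j A) = conn β (j + 1) (conn α i A)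
  conn_conn_self : ∀ {n : ℕ} (α : Bool) (i : ℕ) (A : cell (n + 1)), 1 ≤ i → i ≤ n + 1 →
    conn α (i + 1) (conn α i A) = conn α i (conn α i A)
  conn_deg_lt : ∀ {n : ℕ} (α : Bool) (i j : ℕ) (A : cell (n + 1)), 1 ≤ i → i < j → j ≤ n + 2 →
    conn α i (deg j A) = deg (j + 1) (conn α i A)
  conn_deg_gt : ∀ {n : ℕ} (α : Bool) (i j : ℕ) (A : cell (n + 1)), 1 ≤ j → j ≤ i → i ≤ n + 1 →
    conn α (i + 1) (deg j A) = deg j (conn α i A)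
  conn_deg_self : ∀ {n : ℕ} (α : Bool) (i : ℕ) (A : cell n), 1 ≤ i → i ≤ n + 1 →
    conn α i (deg i A) = deg i (deg i A)

/-- A cubical `ω`-category (with connections). `comp i A B` is the composite `A ⋆_i B`; it is
meaningful exactly when `1 ≤ i ≤ dim` and `∂_i^+ A = ∂_i^- B`, and every axiom about composites is
restricted to that case, so that the values elsewhere play no role. -/
structure CubicalOmegaCat extends CubicalSet.{u} where
  comp : ∀ {n : ℕ}, ℕ → cell (n + 1) → cell (n + 1) → cell (n + 1)
  face_comp_minus : ∀ {n : ℕ} (i : ℕ) (A B : cell (n + 1)), 1 ≤ i → i ≤ n + 1 →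
    face true i A = face false i B →
    face false i (comp i A B) = face false i A
  face_comp_plus : ∀ {n : ℕ} (i : ℕ) (A B : cell (n + 1)), 1 ≤ i → i ≤ n + 1 →
    face true i A = face false i B →
    face true i (comp i A B) = face true i B
  face_comp_lt : ∀ {n : ℕ} (α : Bool) (i j : ℕ) (A B : cell (n + 2)), 1 ≤ i → i ≤ j → j ≤ n + 1 →
    face true (j + 1) A = face false (j + 1) B →
    face α i (comp (j + 1) A B) = comp j (face α i A) (face α i B)
  face_comp_gt : ∀ {n : ℕ} (α : Bool) (i j : ℕ) (A B : cell (n + 2)), 1 ≤ j → j < i → i ≤ n + 2 →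
    face true j A = face false j B →
    face α i (comp j A B) = comp j (face α i A) (face α i B)
  comp_assoc : ∀ {n : ℕ} (i : ℕ) (A B C : cell (n + 1)), 1 ≤ i → i ≤ n + 1 →
    face true i A = face false i B → face true i B = face false i C →
    comp i A (comp i B C) = comp i (comp i A B) C
  comp_exchange : ∀ {n : ℕ} (i j : ℕ) (A B C D : cell (n + 1)),
    1 ≤ i → i ≤ n + 1 → 1 ≤ j → j ≤ n + 1 → i ≠ j →
    face true i A = face false i B → face true i C = face false i D →
    face true j A = face false j C → face true j B = face false j D →
    comp j (comp i A B) (comp i C D) = comp i (comp j A C) (comp j B D)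
  comp_deg : ∀ {n : ℕ} (i : ℕ) (A : cell (n + 1)), 1 ≤ i → i ≤ n + 1 →
    comp i A (deg i (face true i A)) = A
  deg_comp_unit : ∀ {n : ℕ} (i : ℕ) (A : cell (n + 1)), 1 ≤ i → i ≤ n + 1 →
    comp i (deg i (face false i A)) A = A
  deg_comp_le : ∀ {n : ℕ} (i j : ℕ) (A B : cell (n + 1)), 1 ≤ i → i ≤ j → j ≤ n + 1 →
    face true j A = face false j B →
    deg i (comp j A B) = comp (j + 1) (deg i A) (deg i B)
  deg_comp_gt : ∀ {n : ℕ} (i j : ℕ) (A B : cell (n + 1)), 1 ≤ j → j < i → i ≤ n + 2 → j ≤ n + 1 →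
    face true j A = face false j B →
    deg i (comp j A B) = comp j (deg i A) (deg i B)
  conn_comp_conn : ∀ {n : ℕ} (i : ℕ) (A : cell (n + 1)), 1 ≤ i → i ≤ n + 1 →
    comp i (conn true i A) (conn false i A) = deg (i + 1) A
  conn_comp_conn_succ : ∀ {n : ℕ} (i : ℕ) (A : cell (n + 1)), 1 ≤ i → i ≤ n + 1 →
    comp (i + 1) (conn true i A) (conn false i A) = deg i A
  conn_comp_lt : ∀ {n : ℕ} (α : Bool) (i j : ℕ) (A B : cell (n + 1)), 1 ≤ i → i < j → j ≤ n + 1 →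
    face true j A = face false j B →
    conn α i (comp j A B) = comp (j + 1) (conn α i A) (conn α i B)
  conn_comp_gt : ∀ {n : ℕ} (α : Bool) (i j : ℕ) (A B : cell (n + 1)), 1 ≤ j → j < i → i ≤ n + 1 →
    face true j A = face false j B →
    conn α i (comp j A B) = comp j (conn α i A) (conn α i B)
  conn_minus_comp_self : ∀ {n : ℕ} (i : ℕ) (A B : cell (n + 1)), 1 ≤ i → i ≤ n + 1 →
    face true i A = face false i B →
    conn false i (comp i A B) =
      comp (i + 1) (comp i (conn false i A) (deg (i + 1) B)) (comp i (deg i B) (conn false i B))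
  conn_plus_comp_self : ∀ {n : ℕ} (i : ℕ) (A B : cell (n + 1)), 1 ≤ i → i ≤ n + 1 →
    face true i A = face false i B →
    conn true i (comp i A B) =
      comp (i + 1) (comp i (conn true i A) (deg i A)) (comp i (deg (i + 1) A) (conn true i B))

namespace CubicalOmegaCat

variable (C : CubicalOmegaCat.{u})

/-- `B` is an `R_k`-inverse of `A`: both composites `A ⋆_k B` and `B ⋆_k A` are defined, and they are
the degenerate cells on `∂_k^- A` and `∂_k^+ A`. -/
def IsRInverse {n : ℕ} (k : ℕ) (A B : C.cell (n + 1)) : Prop :=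
  C.face true k A = C.face false k B ∧ C.face true k B = C.face false k A ∧
  C.comp k A B = C.deg k (C.face false k A) ∧ C.comp k B A = C.deg k (C.face true k A)

/-- `A` is `R_k`-invertible. -/
def IsRInvertible {n : ℕ} (k : ℕ) (A : C.cell (n + 1)) : Prop :=
  ∃ B, C.IsRInverse k A B

/-- The folding operation
`ψ_i A = Γ_i^+ ∂_{i+1}^- A ⋆_{i+1} A ⋆_{i+1} Γ_i^- ∂_{i+1}^+ A`, for `1 ≤ i < dim A`. -/
def psi {n : ℕ} (i : ℕ) (A : C.cell (n + 2)) : C.cell (n + 2) :=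
  C.comp (i + 1)
    (C.comp (i + 1) (C.conn true i (C.face false (i + 1) A)) A)
    (C.conn false i (C.face true (i + 1) A))

/-- `psiChain m A = ψ_1 ψ_2 ⋯ ψ_m A` (with `ψ_m` applied first). -/
def psiChain {n : ℕ} : ℕ → C.cell (n + 2) → C.cell (n + 2)
  | 0, A => A
  | m + 1, A => psiChain m (C.psi (m + 1) A)

/-- An `n`-cell `A` (`n ≥ 1`) is invertible if `ψ_1 ⋯ ψ_{n-1} A` is `R_1`-invertible. -/
def IsInvertible : ∀ {n : ℕ}, C.cell (n + 1) → Prop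
  | 0, A => C.IsRInvertible 1 A
  | n + 1, A => C.IsRInvertible 1 (C.psiChain (n + 1) A)

/-- A cubical `(ω,p)`-category: every cell of dimension greater than `p` is invertible. -/
def IsOmegaP (p : ℕ) : Prop :=
  ∀ n : ℕ, p < n + 1 → ∀ A : C.cell (n + 1), C.IsInvertible A

/-- `B` is a `T_i`-inverse of `A` (for `1 ≤ i < dim A`): the faces of `B` in the directions `i`, `i+1`
are those of `A` with the two directions exchanged, and the two-dimensional composites of
`Γ_i^+`, `B`, `A`, `Γ_i^-` and of `Γ_i^+`, `A`, `B`, `Γ_i^-` are `Γ_i^- ⋆_i Γ_i^+`. -/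
structure IsTInverse {n : ℕ} (i : ℕ) (A B : C.cell (n + 2)) : Prop where
  face_left : ∀ α : Bool, C.face α i A = C.face α (i + 1) B
  face_right : ∀ α : Bool, C.face α (i + 1) A = C.face α i B
  square_left :
    C.comp (i + 1)
      (C.comp i (C.conn true i (C.face false (i + 1) A)) B)
      (C.comp i A (C.conn false i (C.face true i A))) =
    C.comp i (C.conn false i (C.face false i A)) (C.conn true i (C.face true (i + 1) A))
  square_right :
    C.comp (i + 1)
      (C.comp i (C.conn true i (C.face false (i + 1) B)) A)
      (C.comp i B (C.conn false i (C.face true i B))) =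
    C.comp i (C.conn false i (C.face false i B)) (C.conn true i (C.face true (i + 1) B))

/-- The structure of a symmetric cubical `ω`-category on `C`: maps `T_i : C_n → C_n` for `1 ≤ i < n`
compatible with faces, degeneracies, connections and composition, and satisfying the relations of the
symmetric groups. As before, only the values at legal indices matter. -/
structure SymmetricStructure where
  T : ∀ {n : ℕ}, ℕ → C.cell (n + 2) → C.cell (n + 2)
  -- faces
  face_T_lt : ∀ {n : ℕ} (α : Bool) (i j : ℕ) (A : C.cell (n + 3)), 1 ≤ i → i ≤ j → j ≤ n + 1 →
    C.face α i (T (j + 1) A) = T j (C.face α i A)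
  face_T_gt : ∀ {n : ℕ} (α : Bool) (i j : ℕ) (A : C.cell (n + 3)), 1 ≤ j → j + 1 < i → i ≤ n + 3 →
    C.face α i (T j A) = T j (C.face α i A)
  face_T_self : ∀ {n : ℕ} (α : Bool) (j : ℕ) (A : C.cell (n + 2)), 1 ≤ j → j ≤ n + 1 →
    C.face α j (T j A) = C.face α (j + 1) A
  face_T_succ : ∀ {n : ℕ} (α : Bool) (j : ℕ) (A : C.cell (n + 2)), 1 ≤ j → j ≤ n + 1 →
    C.face α (j + 1) (T j A) = C.face α j A
  -- degeneracies
  T_deg_self : ∀ {n : ℕ} (j : ℕ) (A : C.cell (n + 1)), 1 ≤ j → j ≤ n + 1 →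
    T j (C.deg j A) = C.deg (j + 1) A
  T_deg_succ : ∀ {n : ℕ} (j : ℕ) (A : C.cell (n + 1)), 1 ≤ j → j ≤ n + 1 →
    T j (C.deg (j + 1) A) = C.deg j A
  T_deg_lt : ∀ {n : ℕ} (i j : ℕ) (A : C.cell (n + 2)), 1 ≤ i → i + 1 < j → j ≤ n + 3 →
    T i (C.deg j A) = C.deg j (T i A)
  T_deg_ge : ∀ {n : ℕ} (i j : ℕ) (A : C.cell (n + 2)), 1 ≤ j → j ≤ i → i ≤ n + 1 →
    T (i + 1) (C.deg j A) = C.deg j (T i A)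
  -- connections
  T_conn_self : ∀ {n : ℕ} (α : Bool) (j : ℕ) (A : C.cell (n + 1)), 1 ≤ j → j ≤ n + 1 →
    T j (C.conn α j A) = C.conn α j A
  T_conn_lt : ∀ {n : ℕ} (α : Bool) (i j : ℕ) (A : C.cell (n + 2)), 1 ≤ i → i + 1 < j → j ≤ n + 2 →
    T i (C.conn α j A) = C.conn α j (T i A)
  T_conn_gt : ∀ {n : ℕ} (α : Bool) (i j : ℕ) (A : C.cell (n + 2)), 1 ≤ j → j < i → i ≤ n + 1 →
    T (i + 1) (C.conn α j A) = C.conn α j (T i A)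
  T_conn_T : ∀ {n : ℕ} (α : Bool) (i : ℕ) (A : C.cell (n + 2)), 1 ≤ i → i ≤ n + 1 →
    T (i + 1) (C.conn α i (T i A)) = T i (C.conn α (i + 1) A)
  T_conn_succ_T : ∀ {n : ℕ} (α : Bool) (i : ℕ) (A : C.cell (n + 2)), 1 ≤ i → i ≤ n + 1 →
    T i (C.conn α (i + 1) (T i A)) = T (i + 1) (C.conn α i A)
  -- composition
  T_comp_self : ∀ {n : ℕ} (i : ℕ) (A B : C.cell (n + 2)), 1 ≤ i → i ≤ n + 1 →
    C.face true i A = C.face false i B →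
    T i (C.comp i A B) = C.comp (i + 1) (T i A) (T i B)
  T_comp_succ : ∀ {n : ℕ} (i : ℕ) (A B : C.cell (n + 2)), 1 ≤ i → i ≤ n + 1 →
    C.face true (i + 1) A = C.face false (i + 1) B →
    T i (C.comp (i + 1) A B) = C.comp i (T i A) (T i B)
  T_comp_other : ∀ {n : ℕ} (i j : ℕ) (A B : C.cell (n + 2)), 1 ≤ i → i ≤ n + 1 →
    1 ≤ j → j ≤ n + 2 → j ≠ i → j ≠ i + 1 →
    C.face true j A = C.face false j B →
    T i (C.comp j A B) = C.comp j (T i A) (T i B)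
  -- relations of the symmetric group
  T_T : ∀ {n : ℕ} (i : ℕ) (A : C.cell (n + 2)), 1 ≤ i → i ≤ n + 1 → T i (T i A) = A
  T_braid : ∀ {n : ℕ} (i : ℕ) (A : C.cell (n + 2)), 1 ≤ i → i + 1 ≤ n + 1 →
    T i (T (i + 1) (T i A)) = T (i + 1) (T i (T (i + 1) A))
  T_comm : ∀ {n : ℕ} (i j : ℕ) (A : C.cell (n + 2)), 1 ≤ i → i + 2 ≤ j → j ≤ n + 1 →
    T i (T j A) = T j (T i A)

end CubicalOmegaCat

/-! Restricted to directions `i` and `i + 1`, the cells of a fixed dimension are the squares of a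
double category with connections (`slice`). There a square is determined by its boundary and its
folding, because the connections added by folding can be cancelled again (`unfold_psi`), and every
cell with a suitable boundary is a folding (`psi_unfold`). Folding the equation that defines a
`T_i`-inverse turns one side into `ψ_i A ⋆_i ψ_i B` and the thin side into an identity. So `B` is a
`T_i`-inverse of `A` exactly when the boundaries are exchanged and the foldings are mutually inverse
(`isT_iff`). Uniqueness follows, and existence amounts to `R_i`-invertibility of `ψ_i A`.

The hypothesis only gives `R_1`-invertibility of complete foldings. Transposition moves
invertibility from one direction to the next (`exists_isR2_of_psi`), so `ψ_i ⋯ ψ_{n-1} A` is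
`R_i`-invertible (`isRInvertible_foldChain`). By induction on dimension the foldings in higher
directions can then be undone, provided that the faces of the cell in direction `i + 1` are
degenerate in direction `i`, as those of `ψ_i A` are (`IsGlobular.isRInvertible`).

By uniqueness, any operation respecting faces, connections and compositions in two adjacent
directions commutes with transposition (`T_map`, `IsT.map₂`), which gives most axioms. The hard one
is `T_i T_{i+1} Γ_i^α A = Γ_{i+1}^α T_i A`. For `Γ^-` it is stable under composition, so it is
checked on identities, connections and the folding of `A`, using closed formulas for transposes of
invertible cells. The case of `Γ^+` follows since `Γ^+` is determined by its composite with `Γ^-`.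
Finally `T_{i+1} T_i` respects the double structure, carrying directions `i + 1`, `i + 2` to `i`, `i
+ 1`, and this yields the braid relation. -/

/-- A double category with connections whose two categories of edges coincide. `d1`, `d2` are the
faces of a square, `h1`, `h2` its degeneracies, `c1`, `c2` the two compositions, `g` the connections;
`s`, `e`, `m` are the faces, identities and composition of edges. -/
structure ConnDouble where
  Obj : Type u
  Edge : Type u
  Sq : Type u
  s : Bool → Edge → Obj
  e : Obj → Edge
  m : Edge → Edge → Edge
  d1 : Bool → Sq → Edge
  d2 : Bool → Sq → Edge
  h1 : Edge → Sq
  h2 : Edge → Sq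
  g : Bool → Edge → Sq
  c1 : Sq → Sq → Sq
  c2 : Sq → Sq → Sq
  s_e : ∀ α p, s α (e p) = p
  s_m_false : ∀ x y, s true x = s false y → s false (m x y) = s false x
  s_m_true : ∀ x y, s true x = s false y → s true (m x y) = s true y
  m_e : ∀ x, m x (e (s true x)) = x
  e_m : ∀ x, m (e (s false x)) x = x
  m_assoc : ∀ x y z, s true x = s false y → s true y = s false z → m x (m y z) = m (m x y) z
  s_d2 : ∀ α β A, s α (d2 β A) = s β (d1 α A)
  d1_h1 : ∀ α x, d1 α (h1 x) = x
  d2_h2 : ∀ α x, d2 α (h2 x) = x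
  d2_h1 : ∀ α x, d2 α (h1 x) = e (s α x)
  d1_h2 : ∀ α x, d1 α (h2 x) = e (s α x)
  d1_g_tt : ∀ x, d1 true (g true x) = x
  d1_g_ff : ∀ x, d1 false (g false x) = x
  d2_g_tt : ∀ x, d2 true (g true x) = x
  d2_g_ff : ∀ x, d2 false (g false x) = x
  d1_g_ft : ∀ x, d1 false (g true x) = e (s false x)
  d1_g_tf : ∀ x, d1 true (g false x) = e (s true x)
  d2_g_ft : ∀ x, d2 false (g true x) = e (s false x)
  d2_g_tf : ∀ x, d2 true (g false x) = e (s true x)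
  d1_c1_false : ∀ A B, d1 true A = d1 false B → d1 false (c1 A B) = d1 false A
  d1_c1_true : ∀ A B, d1 true A = d1 false B → d1 true (c1 A B) = d1 true B
  d2_c1 : ∀ α A B, d1 true A = d1 false B → d2 α (c1 A B) = m (d2 α A) (d2 α B)
  d2_c2_false : ∀ A B, d2 true A = d2 false B → d2 false (c2 A B) = d2 false A
  d2_c2_true : ∀ A B, d2 true A = d2 false B → d2 true (c2 A B) = d2 true B
  d1_c2 : ∀ α A B, d2 true A = d2 false B → d1 α (c2 A B) = m (d1 α A) (d1 α B)
  c1_assoc : ∀ A B D, d1 true A = d1 false B → d1 true B = d1 false D →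
    c1 A (c1 B D) = c1 (c1 A B) D
  c2_assoc : ∀ A B D, d2 true A = d2 false B → d2 true B = d2 false D →
    c2 A (c2 B D) = c2 (c2 A B) D
  exch : ∀ A B D F, d1 true A = d1 false B → d1 true D = d1 false F → d2 true A = d2 false D →
    d2 true B = d2 false F → c2 (c1 A B) (c1 D F) = c1 (c2 A D) (c2 B F)
  c1_h1 : ∀ A, c1 A (h1 (d1 true A)) = A
  h1_c1 : ∀ A, c1 (h1 (d1 false A)) A = A
  c2_h2 : ∀ A, c2 A (h2 (d2 true A)) = A
  h2_c2 : ∀ A, c2 (h2 (d2 false A)) A = A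
  h2_e : ∀ p, h2 (e p) = h1 (e p)
  g_e : ∀ α p, g α (e p) = h1 (e p)
  h1_m : ∀ x y, s true x = s false y → h1 (m x y) = c2 (h1 x) (h1 y)
  h2_m : ∀ x y, s true x = s false y → h2 (m x y) = c1 (h2 x) (h2 y)
  g_c1_g : ∀ x, c1 (g true x) (g false x) = h2 x
  g_c2_g : ∀ x, c2 (g true x) (g false x) = h1 x
  g_false_m : ∀ x y, s true x = s false y →
    g false (m x y) = c2 (c1 (g false x) (h2 y)) (c1 (h1 y) (g false y))
  g_true_m : ∀ x y, s true x = s false y →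
    g true (m x y) = c2 (c1 (g true x) (h1 x)) (c1 (h2 x) (g true y))

/-! ### Folding and unfolding of squares. -/

namespace ConnDouble

attribute [simp] s_e s_d2 d1_h1 d2_h2 d2_h1 d1_h2 d1_g_tt d1_g_ff d2_g_tt d2_g_ff d1_g_ft d1_g_tf
  d2_g_ft d2_g_tf h2_e g_e m_e e_m s_m_false s_m_true d1_c1_false d1_c1_true d2_c1 d2_c2_false
  d2_c2_true d1_c2

variable (D : ConnDouble.{u})

lemma c1_unit {A : D.Sq} {x : D.Edge} (h : D.d1 true A = x) : D.c1 A (D.h1 x) = A := by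
  rw [← h, D.c1_h1]

lemma unit_c1 {A : D.Sq} {x : D.Edge} (h : D.d1 false A = x) : D.c1 (D.h1 x) A = A := by
  rw [← h, D.h1_c1]

lemma c2_unit {A : D.Sq} {x : D.Edge} (h : D.d2 true A = x) : D.c2 A (D.h2 x) = A := by
  rw [← h, D.c2_h2]

lemma unit_c2 {A : D.Sq} {x : D.Edge} (h : D.d2 false A = x) : D.c2 (D.h2 x) A = A := by
  rw [← h, D.h2_c2]

lemma c2_unit' {A : D.Sq} {p : D.Obj} (h : D.d2 true A = D.e p) : D.c2 A (D.h1 (D.e p)) = A := by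
  rw [← D.h2_e, D.c2_unit h]

lemma unit_c2' {A : D.Sq} {p : D.Obj} (h : D.d2 false A = D.e p) : D.c2 (D.h1 (D.e p)) A = A := by
  rw [← D.h2_e, D.unit_c2 h]

lemma m_unit {x : D.Edge} {p : D.Obj} (h : D.s true x = p) : D.m x (D.e p) = x := by
  rw [← h, D.m_e]

lemma unit_m {x : D.Edge} {p : D.Obj} (h : D.s false x = p) : D.m (D.e p) x = x := by
  rw [← h, D.e_m]

attribute [simp] c1_unit unit_c1 c2_unit unit_c2 c2_unit' unit_c2' m_unit unit_m

/-- The folding of a square. -/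
def psi (A : D.Sq) : D.Sq :=
  D.c2 (D.c2 (D.g true (D.d2 false A)) A) (D.g false (D.d2 true A))

@[simp] lemma d2_psi_false (A : D.Sq) : D.d2 false (D.psi A) = D.e (D.s false (D.d1 false A)) := by
  simp (maxDischargeDepth := 9) [psi]

@[simp] lemma d2_psi_true (A : D.Sq) : D.d2 true (D.psi A) = D.e (D.s true (D.d1 true A)) := by
  simp (maxDischargeDepth := 9) [psi]

@[simp] lemma d1_psi_false (A : D.Sq) :
    D.d1 false (D.psi A) = D.m (D.d1 false A) (D.d2 true A) := by
  simp (maxDischargeDepth := 9) [psi]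

@[simp] lemma d1_psi_true (A : D.Sq) :
    D.d1 true (D.psi A) = D.m (D.d2 false A) (D.d1 true A) := by
  simp (maxDischargeDepth := 9) [psi]

/-- The `Γ^-` at the end of the folding is absorbed by the `Γ^+` placed before it for `c1`, their
composite being an identity for `c2`. -/
lemma unfold_aux (A : D.Sq) :
    D.c1 (D.c2 (D.h1 (D.d1 false A)) (D.g true (D.d2 true A))) (D.psi A) =
      D.c2 (D.g true (D.d2 false A)) A := by
  -- An identity is inserted so that both rows have three entries and interchange can be applied
  -- column by column.
  conv_lhs => rw [← D.h2_c2 (D.h1 (D.d1 false A))]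
  rw [psi, ← D.exch, ← D.exch, D.g_c1_g] <;> simp (maxDischargeDepth := 9)

/-- The square with faces `a`, `b` (in the first direction), `c`, `d` (in the second direction) whose
folding is `Y`. -/
def unfold (a b c d : D.Edge) (Y : D.Sq) : D.Sq :=
  D.c1 (D.c1 (D.c2 (D.h1 a) (D.g true d)) Y) (D.c2 (D.g false c) (D.h1 b))

lemma unfold_psi (A : D.Sq) :
    D.unfold (D.d1 false A) (D.d1 true A) (D.d2 false A) (D.d2 true A) (D.psi A) = A := by
  rw [unfold, unfold_aux, ← D.exch, D.g_c1_g] <;> simp (maxDischargeDepth := 9)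

/-- Unfolding recovers a square from its boundary and its folding. -/
lemma psi_injective {A B : D.Sq} (h1 : ∀ α, D.d1 α A = D.d1 α B) (h2 : ∀ α, D.d2 α A = D.d2 α B)
    (h : D.psi A = D.psi B) : A = B := by
  rw [← D.unfold_psi A, ← D.unfold_psi B, h, h1, h1, h2, h2]

/-- `Y` has the faces of the folding of a square with faces `a`, `b` in the first and `c`, `d` in the
second direction. -/
structure IsFolded (a b c d : D.Edge) (Y : D.Sq) : Prop where
  s_ff : D.s false a = D.s false c
  s_ft : D.s false b = D.s true c
  s_tf : D.s false d = D.s true a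
  s_tt : D.s true b = D.s true d
  d1_false : D.d1 false Y = D.m a d
  d1_true : D.d1 true Y = D.m c b
  d2_false : D.d2 false Y = D.e (D.s false a)
  d2_true : D.d2 true Y = D.e (D.s true d)

namespace IsFolded

variable {D} {a b c d : D.Edge} {Y : D.Sq} (h : D.IsFolded a b c d Y)

include h

lemma d1_false_unfold : D.d1 false (D.unfold a b c d Y) = a := by
  simp (maxDischargeDepth := 9) [unfold, h.s_ft, h.s_tf, h.d1_false, h.d1_true]

lemma d1_true_unfold : D.d1 true (D.unfold a b c d Y) = b := by
  simp (maxDischargeDepth := 9) [unfold, h.s_ft, h.s_tf, h.d1_false, h.d1_true]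

lemma d2_false_unfold : D.d2 false (D.unfold a b c d Y) = c := by
  simp (maxDischargeDepth := 9) [unfold, h.s_ff, h.s_ft, h.s_tf, h.d1_false, h.d1_true, h.d2_false]

lemma d2_true_unfold : D.d2 true (D.unfold a b c d Y) = d := by
  simp (maxDischargeDepth := 9) [unfold, h.s_ft, h.s_tf, h.s_tt, h.d1_false, h.d1_true, h.d2_true]

/-- Here the connections cancel for `c2`: each `Γ^+` meets a `Γ^-` on the same edge, giving an `h1`,
which the faces of `Y` allow to be absorbed. -/
lemma psi_unfold : D.psi (D.unfold a b c d Y) = Y := by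
  rw [psi, h.d2_false_unfold, h.d2_true_unfold]
  obtain ⟨hff, hft, htf, htt, h1f, h1t, h2f, h2t⟩ := h
  have k1 : D.c2 (D.g true c) (D.unfold a b c d Y) =
      D.c1 (D.c2 (D.h1 a) (D.g true d)) Y := by
    conv_lhs => rw [unfold, ← D.h1_c1 (D.g true c)]
    rw [D.exch, D.c2_assoc, D.g_c2_g, ← D.h1_m, D.c1_unit, D.d1_g_ft, D.unit_c2'] <;>
      simp (maxDischargeDepth := 9) [*]
  rw [k1]
  conv_lhs => rw [← D.c1_h1 (D.g false d)]
  rw [D.exch, ← D.c2_assoc, D.g_c2_g, ← D.h1_m, D.d1_g_tf, D.c2_unit', D.unit_c1] <;>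
    simp (maxDischargeDepth := 9) [*]

end IsFolded

/-! ### Inverses and transposes of squares. -/

/-- `B` is inverse to `A` for `c1`. -/
def IsR1 (A B : D.Sq) : Prop :=
  D.d1 true A = D.d1 false B ∧ D.d1 true B = D.d1 false A ∧
  D.c1 A B = D.h1 (D.d1 false A) ∧ D.c1 B A = D.h1 (D.d1 true A)

/-- `B` is inverse to `A` for `c2`. -/
def IsR2 (A B : D.Sq) : Prop :=
  D.d2 true A = D.d2 false B ∧ D.d2 true B = D.d2 false A ∧
  D.c2 A B = D.h2 (D.d2 false A) ∧ D.c2 B A = D.h2 (D.d2 true A)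

/-- `y` is inverse to `x`. -/
def IsRE (x y : D.Edge) : Prop :=
  D.s true x = D.s false y ∧ D.s true y = D.s false x ∧
  D.m x y = D.e (D.s false x) ∧ D.m y x = D.e (D.s true x)

variable {D}

lemma IsR1.symm {A B : D.Sq} (h : D.IsR1 A B) : D.IsR1 B A :=
  ⟨h.2.1, h.1, by rw [h.2.2.2, h.1], by rw [h.2.2.1, h.2.1]⟩

lemma IsR1.eq_of_c1 {A B B' : D.Sq} (h : D.IsR1 A B) (h0 : D.d1 true A = D.d1 false B')
    (h1 : D.c1 A B' = D.h1 (D.d1 false A)) : B' = B := by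
  rw [← D.c1_unit (x := D.d1 false A) h.2.1, ← h1, D.c1_assoc _ _ _ h.2.1 h0, h.2.2.2, h0, D.h1_c1]

lemma IsR1.unique {A B B' : D.Sq} (h : D.IsR1 A B) (h' : D.IsR1 A B') : B' = B :=
  h.eq_of_c1 h'.1 h'.2.2.1

lemma IsRE.unique {A B B' : D.Edge} (h : D.IsRE A B) (h' : D.IsRE A B') : B' = B := by
  rw [← D.m_unit (p := D.s false A) h.2.1, ← h'.2.2.1, D.m_assoc _ _ _ h.2.1 h'.1, h.2.2.2, h'.1,
    D.e_m]

lemma isR1_h1 (x : D.Edge) : D.IsR1 (D.h1 x) (D.h1 x) := by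
  simp (maxDischargeDepth := 9) [IsR1]

lemma isRE_e (p : D.Obj) : D.IsRE (D.e p) (D.e p) := by
  simp (maxDischargeDepth := 9) [IsRE]

lemma IsR1.c1 {A A' B B' : D.Sq} (hA : D.IsR1 A A') (hB : D.IsR1 B B')
    (h : D.d1 true A = D.d1 false B) : D.IsR1 (D.c1 A B) (D.c1 B' A') := by
  obtain ⟨a1, a2, a3, a4⟩ := hA
  obtain ⟨b1, b2, b3, b4⟩ := hB
  have h' : D.d1 true B' = D.d1 false A' := by rw [b2, ← h, a1]
  refine ⟨by rw [D.d1_c1_true _ _ h, D.d1_c1_false _ _ h', b1],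
    by rw [D.d1_c1_true _ _ h', D.d1_c1_false _ _ h, a2], ?_, ?_⟩
  · rw [D.d1_c1_false _ _ h, ← D.c1_assoc _ _ _ h (by rw [D.d1_c1_false _ _ h', b1]),
      D.c1_assoc _ _ _ b1 h', b3, D.unit_c1 (by rw [← h, a1]), a3]
  · rw [D.d1_c1_true _ _ h, ← D.c1_assoc _ _ _ h' (by rw [D.d1_c1_false _ _ h, a2]),
      D.c1_assoc _ _ _ a2 h, a4, D.unit_c1 h.symm, b4]

lemma IsR1.d2 {A A' : D.Sq} (hA : D.IsR1 A A') (α : Bool) : D.IsRE (D.d2 α A) (D.d2 α A') := by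
  obtain ⟨a1, a2, a3, a4⟩ := hA
  refine ⟨by simp (maxDischargeDepth := 9) [*], by simp (maxDischargeDepth := 9) [*], ?_, ?_⟩
  · rw [← D.d2_c1 _ _ _ a1, a3]; simp
  · rw [← D.d2_c1 _ _ _ a2, a4]; simp

lemma IsR1.c2 {A A' B B' : D.Sq} (hA : D.IsR1 A A') (hB : D.IsR1 B B')
    (h : D.d2 true A = D.d2 false B) : D.IsR1 (D.c2 A B) (D.c2 A' B') := by
  -- The inverse squares are composable because both common edges are inverse to the same edge.
  have h' : D.d2 true A' = D.d2 false B' := (hB.d2 false).unique (h ▸ hA.d2 true)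
  have hA2 := hA.d2 true
  obtain ⟨a1, a2, a3, a4⟩ := hA
  obtain ⟨b1, b2, b3, b4⟩ := hB
  have k : D.s false (D.d2 true A) = D.s false (D.d2 false B) := by rw [h]
  have k' : D.s true (D.d2 true A) = D.s true (D.d2 false B) := by rw [h]
  simp only [s_d2] at k k'
  refine ⟨by simp (maxDischargeDepth := 9) [*], by simp (maxDischargeDepth := 9) [*], ?_, ?_⟩
  · rw [← D.exch _ _ _ _ a1 b1 h h', a3, b3, ← D.h1_m _ _ k, D.d1_c2 _ _ _ h]
  · rw [← D.exch _ _ _ _ a2 b2 h' h, a4, b4, ← D.h1_m _ _ k', D.d1_c2 _ _ _ h]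

variable (D) in
/-- `B` is a transpose of `A`. -/
structure IsT (A B : D.Sq) : Prop where
  face_left : ∀ α : Bool, D.d1 α A = D.d2 α B
  face_right : ∀ α : Bool, D.d2 α A = D.d1 α B
  square_left :
    D.c2 (D.c1 (D.g true (D.d2 false A)) B) (D.c1 A (D.g false (D.d1 true A))) =
      D.c1 (D.g false (D.d1 false A)) (D.g true (D.d2 true A))
  square_right :
    D.c2 (D.c1 (D.g true (D.d2 false B)) A) (D.c1 B (D.g false (D.d1 true B))) =
      D.c1 (D.g false (D.d1 false B)) (D.g true (D.d2 true B))

lemma IsT.symm {A B : D.Sq} (h : D.IsT A B) : D.IsT B A :=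
  ⟨fun α => (h.face_right α).symm, fun α => (h.face_left α).symm, h.square_right, h.square_left⟩

/-- The thin side of the transpose equation folds to an identity. -/
lemma psi_thin (a d : D.Edge) (h : D.s true a = D.s false d) :
    D.psi (D.c1 (D.g false a) (D.g true d)) = D.h1 (D.m a d) := by
  have e1 : D.d2 false (D.c1 (D.g false a) (D.g true d)) = a := by simp [← h]
  have e2 : D.d2 true (D.c1 (D.g false a) (D.g true d)) = d := by simp [h]
  rw [psi, e1, e2]
  conv_lhs => rw [← D.c1_h1 (D.g true a), ← D.h1_c1 (D.g false d)]
  rw [D.exch, D.exch, D.g_c2_g, ← D.c2_assoc, D.g_c2_g, D.d1_g_tt, D.d1_g_ff, ← D.h1_m, D.c1_unit] <;>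
    simp (maxDischargeDepth := 9) [h]

/-- The other side of the transpose equation is a 2×2 array; interchange splits its folding into two
rows, which are the foldings of `A` and `B`. -/
lemma psi_square {A B : D.Sq} (h1 : ∀ α : Bool, D.d1 α A = D.d2 α B)
    (h2 : ∀ α : Bool, D.d2 α A = D.d1 α B) :
    D.psi (D.c2 (D.c1 (D.g true (D.d2 false A)) B) (D.c1 A (D.g false (D.d1 true A)))) =
      D.c1 (D.psi A) (D.psi B) := by
  have e1 : D.d2 false (D.c2 (D.c1 (D.g true (D.d2 false A)) B)
      (D.c1 A (D.g false (D.d1 true A)))) = D.d1 false A := by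
    simp [← h1, ← h2]
  have e2 : D.d2 true (D.c2 (D.c1 (D.g true (D.d2 false A)) B)
      (D.c1 A (D.g false (D.d1 true A)))) = D.d2 true A := by
    simp [← h1, ← h2]
  rw [psi, e1, e2, D.exch]
  · conv_lhs => rw [← D.h1_c1 (D.g true (D.d1 false A)), ← D.c1_h1 (D.g false (D.d2 true A))]
    rw [D.exch, D.exch]
    · rw [D.d1_g_ft, D.d1_g_tf, D.unit_c2', D.c2_unit', D.c2_assoc (D.g true (D.d1 false A)), psi, psi, ← h1,
        ← h1]
      all_goals simp (maxDischargeDepth := 9) [← h1]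
    all_goals simp (maxDischargeDepth := 9) [← h1, ← h2]
  all_goals simp (maxDischargeDepth := 9) [← h1, ← h2]


end ConnDouble

/-! ### Transposes through inverses of foldings. -/

namespace ConnDouble
variable {D : ConnDouble.{u}}

/-- Both sides of each transpose equation have the same boundary, so by `psi_injective` they may be
compared after folding, where `psi_square` and `psi_thin` evaluate them. -/
lemma isT_iff {A B : D.Sq} : D.IsT A B ↔ (∀ α, D.d1 α A = D.d2 α B) ∧ (∀ α, D.d2 α A = D.d1 α B) ∧
    D.IsR1 (D.psi A) (D.psi B) := by
  have key : ∀ {A B : D.Sq} (h1 : ∀ α : Bool, D.d1 α A = D.d2 α B)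
      (h2 : ∀ α : Bool, D.d2 α A = D.d1 α B),
      D.c2 (D.c1 (D.g true (D.d2 false A)) B) (D.c1 A (D.g false (D.d1 true A))) =
      D.c1 (D.g false (D.d1 false A)) (D.g true (D.d2 true A)) ↔
      D.c1 (D.psi A) (D.psi B) = D.h1 (D.d1 false (D.psi A)) := by
    intro A B h1 h2
    rw [← psi_square h1 h2, d1_psi_false, ← psi_thin _ _ (by simp)]
    refine ⟨fun h => by rw [h], fun h => D.psi_injective ?_ ?_ h⟩ <;> rintro (_ | _) <;>
      simp (maxDischargeDepth := 9) [← h1, ← h2]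
  constructor
  · intro h
    refine ⟨h.face_left, h.face_right, by simp [h.face_left, h.face_right],
      by simp [h.face_left, h.face_right], (key h.face_left h.face_right).1 h.square_left, ?_⟩
    rw [(key h.symm.face_left h.symm.face_right).1 h.square_right]
    simp [h.face_left, h.face_right]
  · rintro ⟨h1, h2, h⟩
    refine ⟨h1, h2, (key h1 h2).2 h.2.2.1,
      (key (fun α => (h2 α).symm) (fun α => (h1 α).symm)).2 ?_⟩
    rw [h.2.2.2, h.1]

lemma IsT.unique {A B B' : D.Sq} (h : D.IsT A B) (h' : D.IsT A B') : B' = B :=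
  D.psi_injective (fun α => by rw [← h.face_right, h'.face_right])
    (fun α => by rw [← h.face_left, h'.face_left]) ((isT_iff.1 h).2.2.unique (isT_iff.1 h').2.2)

/-- The inverse of `psi A` again has identities as its `d2`-faces, since the inverse of an identity
edge is that edge. Hence it unfolds to a square with the exchanged boundary. -/
lemma exists_isT {A : D.Sq} (h : ∃ Y, D.IsR1 (D.psi A) Y) : ∃ B, D.IsT A B := by
  obtain ⟨Y, h⟩ := h
  have hf : D.IsFolded (D.d2 false A) (D.d2 true A) (D.d1 false A) (D.d1 true A) Y := by
    refine ⟨by simp, by simp, by simp, by simp, by simp [← h.1], by simp [h.2.1], ?_, ?_⟩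
    · refine IsRE.unique (A := D.d2 false (D.psi A)) ?_ (h.d2 false)
      simpa using D.isRE_e (D.s false (D.d1 false A))
    · refine IsRE.unique (A := D.d2 true (D.psi A)) ?_ (h.d2 true)
      simpa using D.isRE_e (D.s true (D.d1 true A))
  refine ⟨D.unfold (D.d2 false A) (D.d2 true A) (D.d1 false A) (D.d1 true A) Y, isT_iff.2 ⟨?_, ?_, ?_⟩⟩
  · rintro (_ | _)
    · exact hf.d2_false_unfold.symm
    · exact hf.d2_true_unfold.symm
  · rintro (_ | _)
    · exact hf.d1_false_unfold.symm
    · exact hf.d1_true_unfold.symm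
  · rwa [hf.psi_unfold]

lemma psi_c1 {A A' : D.Sq} (h : D.d1 true A = D.d1 false A') :
    D.psi (D.c1 A A') = D.c1 (D.c2 (D.psi A) (D.h1 (D.d2 true A')))
      (D.c2 (D.h1 (D.d2 false A)) (D.psi A')) := by
  have k1 : D.c2 (D.g true (D.m (D.d2 false A) (D.d2 false A'))) (D.c1 A A') =
      D.c1 (D.c2 (D.g true (D.d2 false A)) A)
        (D.c2 (D.h1 (D.d2 false A)) (D.c2 (D.g true (D.d2 false A')) A')) := by
    rw [D.g_true_m, ← D.c2_assoc, D.exch (D.h2 _), D.unit_c2, D.exch]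
    all_goals simp (maxDischargeDepth := 9) [h]
  rw [psi, D.d2_c1 _ _ _ h, D.d2_c1 _ _ _ h, k1, D.g_false_m, D.c2_assoc, D.exch, D.c2_unit, D.exch,
    psi, psi,
    D.c2_assoc (D.h1 (D.d2 false A)) (D.c2 _ _)]
  all_goals simp (maxDischargeDepth := 9) [h]

lemma psi_c2 {B B' : D.Sq} (h : D.d2 true B = D.d2 false B') :
    D.psi (D.c2 B B') = D.c1 (D.c2 (D.h1 (D.d1 false B)) (D.psi B'))
      (D.c2 (D.psi B) (D.h1 (D.d1 true B'))) := by
  have k : ∀ α, D.s α (D.d2 true B) = D.s α (D.d2 false B') := fun α => by rw [h]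
  simp only [s_d2] at k
  have e1 : D.c2 (D.h1 (D.d1 false B)) (D.psi B') =
      D.c2 (D.c2 (D.c2 (D.c2 (D.h1 (D.e (D.s false (D.d1 false B)))) (D.h1 (D.d1 false B)))
        (D.g true (D.d2 false B'))) B') (D.g false (D.d2 true B')) := by
    rw [D.unit_c2', psi, D.c2_assoc, D.c2_assoc]
    all_goals simp (maxDischargeDepth := 9) [k]
  have e2 : D.c2 (D.psi B) (D.h1 (D.d1 true B')) =
      D.c2 (D.c2 (D.c2 (D.c2 (D.g true (D.d2 false B)) B) (D.g false (D.d2 true B)))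
        (D.h1 (D.d1 true B'))) (D.h1 (D.e (D.s true (D.d1 true B')))) := by
    rw [D.c2_unit', psi]
    all_goals simp (maxDischargeDepth := 9) [h]
  rw [e1, e2, ← D.exch, ← D.exch, ← D.exch, ← D.exch, h, D.g_c1_g, D.c2_unit, psi, D.c2_assoc]
  all_goals simp (maxDischargeDepth := 9) [h, k]

/-- The foldings of `A ⋆_1 A'` and of `B ⋆_2 B'` are products of two whiskered foldings taken in
opposite orders, just as the inverse of a product requires. -/
lemma IsT.c1 {A B A' B' : D.Sq} (h : D.IsT A B) (h' : D.IsT A' B')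
    (hA : D.d1 true A = D.d1 false A') : D.IsT (D.c1 A A') (D.c2 B B') := by
  have hB : D.d2 true B = D.d2 false B' := by rw [← h.face_left, ← h'.face_left, hA]
  refine isT_iff.2 ⟨?_, ?_, ?_⟩
  · rintro (_ | _) <;> simp [hA, hB, h.face_left, h'.face_left]
  · rintro (_ | _) <;> simp [hA, hB, h.face_right, h'.face_right]
  · rw [psi_c1 hA, psi_c2 hB, ← h.face_right, ← h'.face_right]
    refine IsR1.c1 (IsR1.c2 (isT_iff.1 h).2.2 (isR1_h1 _) ?_)
      (IsR1.c2 (isR1_h1 _) (isT_iff.1 h').2.2 ?_) ?_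
    all_goals simp (maxDischargeDepth := 9) [hA, m_assoc]

lemma IsT.c2 {A B A' B' : D.Sq} (h : D.IsT A B) (h' : D.IsT A' B')
    (hA : D.d2 true A = D.d2 false A') : D.IsT (D.c2 A A') (D.c1 B B') :=
  (IsT.c1 h.symm h'.symm (by rw [← h.face_right, ← h'.face_right, hA])).symm

lemma isT_h1 (x : D.Edge) : D.IsT (D.h1 x) (D.h2 x) := by
  refine isT_iff.2 ⟨by simp, by simp, ?_⟩
  have e1 : D.psi (D.h1 x) = D.h1 x := by simp [psi]
  have e2 : D.psi (D.h2 x) = D.h1 x := by simp [psi, g_c2_g]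
  rw [e1, e2]
  exact isR1_h1 x

lemma psi_g (α : Bool) (x : D.Edge) : D.psi (D.g α x) = D.h1 x := by
  cases α <;> simp [psi, g_c2_g]

lemma isT_g (α : Bool) (x : D.Edge) : D.IsT (D.g α x) (D.g α x) := by
  refine isT_iff.2 ⟨?_, ?_, ?_⟩
  · cases α <;> rintro (_ | _) <;> simp
  · cases α <;> rintro (_ | _) <;> simp
  · rw [psi_g]
    exact isR1_h1 x

/-! ### Invertibility of squares and of their foldings. -/

lemma IsRE.isR1_g_false {x y : D.Edge} (h : D.IsRE x y) : ∃ W, D.IsR1 (D.g false x) W := by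
  obtain ⟨a1, a2, a3, a4⟩ := h
  -- The witness is read off from the formula for `Γ^-(x y)`: as `x y` is an identity, the 2×2 array
  -- built from `Γ^- x` and `Γ^- y` is an identity as well.
  refine ⟨D.c2 (D.c2 (D.h2 y) (D.g false y)) (D.h1 x), ?_, ?_, ?_, ?_⟩
  · simp [*]
  · simp [*]
  · have e1 : D.g false x = D.c2 (D.c2 (D.g false x) (D.h1 y)) (D.h1 x) := by
      rw [← D.c2_assoc, ← D.h1_m, a4, D.c2_unit'] <;> simp [*]
    conv_lhs => rw [e1]
    rw [← D.exch, ← D.exch, ← D.g_false_m _ _ a1, a3]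
    all_goals simp [a1, a2]
  · have e1 : D.g false x = D.c2 (D.c2 (D.h2 x) (D.h2 x)) (D.g false x) := by simp
    conv_lhs => rw [e1]
    rw [← D.exch, ← D.exch, ← D.h2_m _ _ a2, a4, D.unit_c2, ← D.g_false_m _ _ a2, a4]
    all_goals simp [a1, a2, a4]

lemma IsRE.isR1_h2 {x y : D.Edge} (h : D.IsRE x y) : D.IsR1 (D.h2 x) (D.h2 y) := by
  obtain ⟨a1, a2, a3, a4⟩ := h
  refine ⟨by simp [*], by simp [*], ?_, ?_⟩ <;> rw [← D.h2_m] <;> simp [*]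

/-- The case of `Γ^+` follows from that of `Γ^-`, because `Γ^+ ⋆_1 Γ^- = h2 x` and `h2 x` is
invertible. -/
lemma isR1_g {x : D.Edge} (h : ∃ y, D.IsRE x y) (α : Bool) : ∃ W, D.IsR1 (D.g α x) W := by
  obtain ⟨y, h⟩ := h
  obtain ⟨W, hW⟩ := h.isR1_g_false
  cases α
  · exact ⟨W, hW⟩
  · have e1 : D.g true x = D.c1 (D.h2 x) W := by
      rw [← D.g_c1_g, ← D.c1_assoc _ _ _ (by simp) hW.1, hW.2.2.1, D.c1_unit]
      simp
    rw [e1]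
    exact ⟨_, h.isR1_h2.c1 hW.symm (by simp [hW.1.symm])⟩

lemma exists_isR1_c1 {A B : D.Sq} (hA : ∃ A', D.IsR1 A A') (hB : ∃ B', D.IsR1 B B')
    (h : D.d1 true A = D.d1 false B) : ∃ X, D.IsR1 (D.c1 A B) X := by
  obtain ⟨A', hA⟩ := hA
  obtain ⟨B', hB⟩ := hB
  exact ⟨_, hA.c1 hB h⟩

lemma exists_isR1_c2 {A B : D.Sq} (hA : ∃ A', D.IsR1 A A') (hB : ∃ B', D.IsR1 B B')
    (h : D.d2 true A = D.d2 false B) : ∃ X, D.IsR1 (D.c2 A B) X := by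
  obtain ⟨A', hA⟩ := hA
  obtain ⟨B', hB⟩ := hB
  exact ⟨_, hA.c2 hB h⟩

lemma exists_isR1_psi {A : D.Sq} (h : ∃ B, D.IsR1 A B) : ∃ Y, D.IsR1 (D.psi A) Y := by
  obtain ⟨B, h⟩ := h
  refine exists_isR1_c2 (exists_isR1_c2 (isR1_g ⟨_, h.d2 _⟩ _) ⟨_, h⟩ ?_) (isR1_g ⟨_, h.d2 _⟩ _) ?_ <;>
    simp

/-- Unfolding writes `A` as a composite of its folding, identities, and connections on its
`d2`-faces, all of them invertible. -/
lemma exists_isR1_of_psi {A : D.Sq} (h : ∃ Y, D.IsR1 (D.psi A) Y)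
    (h2 : ∀ α, ∃ y, D.IsRE (D.d2 α A) y) : ∃ B, D.IsR1 A B := by
  rw [← D.unfold_psi A]
  refine exists_isR1_c1 (exists_isR1_c1 (exists_isR1_c2 ⟨_, isR1_h1 _⟩ (isR1_g (h2 _) _) ?_) h ?_)
    (exists_isR1_c2 (isR1_g (h2 _) _) ⟨_, isR1_h1 _⟩ ?_) ?_ <;> simp

/-- The transpose `B` of `A` has an invertible folding, and its `d2`-faces are the `d1`-faces of
`A`, so it has a `c1`-inverse. Transposing that inverse gives a `c2`-inverse of `A`. -/
lemma exists_isR2_of_psi {A : D.Sq} (h : ∃ Y, D.IsR1 (D.psi A) Y)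
    (h1 : ∀ α, ∃ y, D.IsRE (D.d1 α A) y) : ∃ B, D.IsR2 A B := by
  obtain ⟨B, hB⟩ := exists_isT h
  obtain ⟨B', hB'⟩ := exists_isR1_of_psi ⟨_, (isT_iff.1 hB).2.2.symm⟩
    (fun α => by rw [← hB.face_left]; exact h1 α)
  obtain ⟨A', hA'⟩ := exists_isT (exists_isR1_psi ⟨_, hB'.symm⟩)
  refine ⟨A', ?_, ?_, ?_, ?_⟩
  · rw [hB.face_right, ← hA'.face_left, hB'.1]
  · rw [hB.face_right, ← hA'.face_left, hB'.2.1]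
  · refine (isT_h1 (D.d1 false B)).unique ?_ |>.trans ?_
    · rw [← hB'.2.2.1]
      exact hB.symm.c1 hA' hB'.1
    · rw [hB.face_right]
  · refine (isT_h1 (D.d1 true B)).unique ?_ |>.trans ?_
    · rw [← hB'.2.2.2]
      exact hA'.c1 hB.symm hB'.2.1
    · rw [hB.face_right]

/-! ### Explicit transposes, and recognition of connections. -/

lemma g_true_m_unit {x y : D.Edge} (h : D.s true x = D.s false y) :
    D.c2 (D.g true x) (D.c1 (D.h2 x) (D.g true y)) = D.g true (D.m x y) := by
  rw [D.g_true_m _ _ h, D.c1_unit]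
  simp

lemma g_true_m_unit' {x y : D.Edge} (h : D.s true x = D.s false y) :
    D.c1 (D.g true x) (D.c2 (D.h1 x) (D.g true y)) = D.g true (D.m x y) := by
  rw [D.g_true_m _ _ h, D.exch, D.c2_unit] <;> simp [h]

/-- A property of squares that is stable under composition can be checked on foldings. -/
lemma of_psi (P : D.Sq → Prop) (hc1 : ∀ X Y, D.d1 true X = D.d1 false Y → P X → P Y → P (D.c1 X Y))
    (hc2 : ∀ X Y, D.d2 true X = D.d2 false Y → P X → P Y → P (D.c2 X Y)) {A : D.Sq}
    (h : P (D.psi A)) (h1 : ∀ α, P (D.h1 (D.d1 α A))) (hg : ∀ α β, P (D.g β (D.d2 α A))) : P A := by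
  rw [← D.unfold_psi A]
  refine hc1 _ _ ?_ (hc1 _ _ ?_ (hc2 _ _ ?_ (h1 _) (hg _ _)) h) (hc2 _ _ ?_ (hg _ _) (h1 _)) <;> simp

/-- The transpose of a square that is invertible for `c1` and has a degenerate face. -/
lemma IsT.eq_of_isR1 {A A' B : D.Sq} (h : D.IsT A B) (hA : D.IsR1 A A') {q : D.Obj}
    (hq : D.d2 true A = D.e q) :
    B = D.c1 (D.c1 (D.g false (D.d2 false A)) (D.g true (D.d1 true A)))
      (D.c1 A' (D.g false (D.d1 false A))) := by
  have hs := h.square_right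
  have hA2 := hA.d2 true
  obtain ⟨a1, a2, a3, a4⟩ := hA
  have e1 : D.d2 true A' = D.e q := by
    rw [hq] at hA2
    exact (isRE_e q).unique hA2
  have k : ∀ α, D.s α (D.d2 true A) = q := fun α => by rw [hq, s_e]
  simp only [s_d2] at k
  rw [← h.face_left, ← h.face_right, ← h.face_right, ← h.face_left, hq, g_e,
    D.c1_unit (by rw [← h.face_right, hq])] at hs
  have f1 := h.face_left
  have f2 := h.face_right
  have f3 : D.d1 true B = D.e q := by rw [← f2, hq]
  have e2 : D.d2 true (D.c1 A' (D.g false (D.d1 false A))) = D.e q := by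
    simp [a2, e1, k]
  -- With a degenerate face, the transpose equation reads `(Γ^+ ⋆_1 A) ⋆_2 B = Γ^- ⋆_1 Γ^+`.
  -- Composing with `A' ⋆_1 Γ^-` for `c1` makes the first column an identity and leaves `B`.
  rw [← hs]
  conv_rhs => rw [← D.c2_h2 (D.c1 A' (D.g false (D.d1 false A)))]
  rw [← D.exch, D.c1_assoc, ← D.c1_assoc _ A, a3, D.c1_unit, D.g_c1_g, e2, D.h2_e, D.c1_unit f3,
    f1, D.h2_c2]
  all_goals try rw [e2]
  all_goals simp [a1, a2, hq, k, f3, ← f1]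

lemma IsT.eq_of_isR1_of_degenerate {A A' B : D.Sq} (h : D.IsT A B) (hA : D.IsR1 A A') {p q : D.Obj}
    (hp : D.d2 false A = D.e p) (hq : D.d2 true A = D.e q) :
    B = D.c1 (D.g true (D.d1 true A)) (D.c1 A' (D.g false (D.d1 false A))) := by
  have k := congrArg (D.s true) hp
  rw [D.s_d2, D.s_e] at k
  rw [h.eq_of_isR1 hA hq, hp, D.g_e, D.unit_c1]
  rw [D.d1_g_ft, k]

/-- The connection `g false x` is determined by its composite with `g true x`. -/
lemma eq_g_false {x : D.Edge} {X : D.Sq} {p : D.Obj} (h1 : D.d1 false X = x) (h2 : D.d2 true X = D.e p)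
    (h : D.c1 (D.g true x) X = D.h2 x) : X = D.g false x := by
  have hp : D.s true x = p := by
    rw [← h1, ← D.s_d2, h2, D.s_e]
  -- The array with rows `Γ^+, Γ^-` and `X, 1` composes to `X` by rows; by columns, the hypothesis
  -- makes it `Γ^-`.
  have e1 : D.c2 (D.c1 (D.g true x) X) (D.c1 (D.g false x) (D.h1 (D.e p))) = X := by
    rw [D.exch, D.g_c2_g, D.c2_unit', D.unit_c1] <;> simp [*]
  rw [← e1, h, D.c1_unit, D.unit_c2] <;> simp [*]

/-- The connection `g true x` is determined by its composite with `g false x`. -/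
lemma eq_g_true {x : D.Edge} {X : D.Sq} {p : D.Obj} (h1 : D.d1 true X = x) (h2 : D.d2 false X = D.e p)
    (h : D.c1 X (D.g false x) = D.h2 x) : X = D.g true x := by
  have hp : D.s false x = p := by
    rw [← h1, ← D.s_d2, h2, D.s_e]
  have e1 : D.c2 (D.c1 (D.h1 (D.e p)) (D.g true x)) (D.c1 X (D.g false x)) = X := by
    rw [D.exch, D.g_c2_g, D.unit_c2', D.c1_unit] <;> simp [*]
  rw [← e1, h, D.unit_c1, D.c2_unit] <;> simp [*]

/-! ### Transport of transposes along operations. -/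

/-- Transposes are preserved by maps of double categories with connections. -/
lemma IsT.map {D' : ConnDouble.{u}} (F : D.Sq → D'.Sq) (G : D.Edge → D'.Edge)
    (hd1 : ∀ α A, D'.d1 α (F A) = G (D.d1 α A)) (hd2 : ∀ α A, D'.d2 α (F A) = G (D.d2 α A))
    (hg : ∀ α x, F (D.g α x) = D'.g α (G x))
    (hc1 : ∀ A B, D.d1 true A = D.d1 false B → F (D.c1 A B) = D'.c1 (F A) (F B))
    (hc2 : ∀ A B, D.d2 true A = D.d2 false B → F (D.c2 A B) = D'.c2 (F A) (F B))
    {A B : D.Sq} (h : D.IsT A B) : D'.IsT (F A) (F B) := by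
  have key : ∀ {A B : D.Sq}, D.IsT A B →
      D'.c2 (D'.c1 (D'.g true (D'.d2 false (F A))) (F B))
        (D'.c1 (F A) (D'.g false (D'.d1 true (F A)))) =
      D'.c1 (D'.g false (D'.d1 false (F A))) (D'.g true (D'.d2 true (F A))) := by
    intro A B h
    have := congrArg F h.square_left
    rw [hc2, hc1, hc1, hc1, hg, hg, hg, hg] at this
    · rw [hd1, hd1, hd2, hd2, this]
    all_goals simp (maxDischargeDepth := 9) [h.face_left, h.face_right]
  exact ⟨fun α => by rw [hd1, hd2, h.face_left], fun α => by rw [hd1, hd2, h.face_right],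
    key h, key h.symm⟩

/-- Transposes are preserved by partial binary operations that commute with the structure of double
categories with connections. -/
lemma IsT.map₂ (R : D.Sq → D.Sq → Prop) (R' : D.Edge → D.Edge → Prop) (F : D.Sq → D.Sq → D.Sq)
    (G : D.Edge → D.Edge → D.Edge)
    (hd1 : ∀ α A B, R A B → R' (D.d1 α A) (D.d1 α B) ∧ D.d1 α (F A B) = G (D.d1 α A) (D.d1 α B))
    (hd2 : ∀ α A B, R A B → R' (D.d2 α A) (D.d2 α B) ∧ D.d2 α (F A B) = G (D.d2 α A) (D.d2 α B))
    (hg : ∀ α x y, R' x y → R (D.g α x) (D.g α y) ∧ F (D.g α x) (D.g α y) = D.g α (G x y))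
    (hc1 : ∀ A B A' B', R A B → R A' B' → D.d1 true A = D.d1 false A' → D.d1 true B = D.d1 false B' →
      R (D.c1 A A') (D.c1 B B') ∧ F (D.c1 A A') (D.c1 B B') = D.c1 (F A B) (F A' B'))
    (hc2 : ∀ A B A' B', R A B → R A' B' → D.d2 true A = D.d2 false A' → D.d2 true B = D.d2 false B' →
      F (D.c2 A A') (D.c2 B B') = D.c2 (F A B) (F A' B'))
    {A B A' B' : D.Sq} (h : D.IsT A A') (h' : D.IsT B B') (hR : R A B) (hR' : R A' B') :
    D.IsT (F A B) (F A' B') := by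
  have key : ∀ {A B A' B' : D.Sq}, D.IsT A A' → D.IsT B B' → R A B → R A' B' →
      D.c2 (D.c1 (D.g true (D.d2 false (F A B))) (F A' B'))
        (D.c1 (F A B) (D.g false (D.d1 true (F A B)))) =
      D.c1 (D.g false (D.d1 false (F A B))) (D.g true (D.d2 true (F A B))) := by
    intro A B A' B' h h' hR hR'
    have g1 := fun α β => hg α _ _ (hd1 β _ _ hR).1
    have g2 := fun α β => hg α _ _ (hd2 β _ _ hR).1
    have e1 := hc1 _ _ _ _ (g2 true false).1 hR' (by simp [h.face_right]) (by simp [h'.face_right])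
    have e2 := hc1 _ _ _ _ hR (g1 false true).1 (by simp) (by simp)
    have e3 := hc1 _ _ _ _ (g1 false false).1 (g2 true true).1 (by simp) (by simp)
    have e4 := hc2 _ _ _ _ e1.1 e2.1 (by simp [h.face_left, h.face_right])
      (by simp [h'.face_left, h'.face_right])
    rw [h.square_left, h'.square_left, e3.2, e1.2, e2.2, (g2 _ _).2, (g2 _ _).2, (g1 _ _).2,
      (g1 _ _).2] at e4
    rw [(hd1 _ _ _ hR).2, (hd1 _ _ _ hR).2, (hd2 _ _ _ hR).2, (hd2 _ _ _ hR).2, e4]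
  exact ⟨fun α => by rw [(hd1 _ _ _ hR).2, (hd2 _ _ _ hR').2, h.face_left, h'.face_left],
    fun α => by rw [(hd2 _ _ _ hR).2, (hd1 _ _ _ hR').2, h.face_right, h'.face_right],
    key h h' hR hR', key h.symm h'.symm hR' hR⟩

end ConnDouble

/-! ### Passage from cubical categories to double categories. -/

namespace CubicalOmegaCat
variable (C : CubicalOmegaCat.{u})

/-- The double category with connections formed by the `(n + 2)`-cells in the directions `i`
and `i + 1`. -/
def slice (n i : ℕ) (hi : 1 ≤ i) (hn : i ≤ n + 1) : ConnDouble.{u} where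
  Obj := C.cell n
  Edge := C.cell (n + 1)
  Sq := C.cell (n + 2)
  s α := C.face α i
  e := C.deg i
  m := C.comp i
  d1 α := C.face α i
  d2 α := C.face α (i + 1)
  h1 := C.deg i
  h2 := C.deg (i + 1)
  g α := C.conn α i
  c1 := C.comp i
  c2 := C.comp (i + 1)
  s_e α p := C.face_deg_self α i p hi hn
  s_m_false x y h := C.face_comp_minus i x y hi hn h
  s_m_true x y h := C.face_comp_plus i x y hi hn h
  m_e x := C.comp_deg i x hi hn
  e_m x := C.deg_comp_unit i x hi hn
  m_assoc x y z h h' := C.comp_assoc i x y z hi hn h h'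
  s_d2 α β A := (C.face_face β α i i A hi le_rfl hn).symm
  d1_h1 α x := C.face_deg_self α i x hi (by omega)
  d2_h2 α x := C.face_deg_self α (i + 1) x (by omega) (by omega)
  d2_h1 α x := C.face_deg_gt α i i x hi le_rfl hn
  d1_h2 α x := C.face_deg_lt α i i x hi le_rfl hn
  d1_g_tt x := C.face_conn_same true i x hi hn
  d1_g_ff x := C.face_conn_same false i x hi hn
  d2_g_tt x := C.face_conn_same_succ true i x hi hn
  d2_g_ff x := C.face_conn_same_succ false i x hi hn
  d1_g_ft x := C.face_conn_opp false i x hi hn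
  d1_g_tf x := C.face_conn_opp true i x hi hn
  d2_g_ft x := C.face_conn_opp_succ false i x hi hn
  d2_g_tf x := C.face_conn_opp_succ true i x hi hn
  d1_c1_false A B h := C.face_comp_minus i A B hi (by omega) h
  d1_c1_true A B h := C.face_comp_plus i A B hi (by omega) h
  d2_c1 α A B h := C.face_comp_gt α (i + 1) i A B hi (by omega) (by omega) h
  d2_c2_false A B h := C.face_comp_minus (i + 1) A B (by omega) (by omega) h
  d2_c2_true A B h := C.face_comp_plus (i + 1) A B (by omega) (by omega) h
  d1_c2 α A B h := C.face_comp_lt α i i A B hi le_rfl hn h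
  c1_assoc A B D h h' := C.comp_assoc i A B D hi (by omega) h h'
  c2_assoc A B D h h' := C.comp_assoc (i + 1) A B D (by omega) (by omega) h h'
  exch A B D F h h' k k' := C.comp_exchange i (i + 1) A B D F hi (by omega) (by omega) (by omega)
    (by omega) h h' k k'
  c1_h1 A := C.comp_deg i A hi (by omega)
  h1_c1 A := C.deg_comp_unit i A hi (by omega)
  c2_h2 A := C.comp_deg (i + 1) A (by omega) (by omega)
  h2_c2 A := C.deg_comp_unit (i + 1) A (by omega) (by omega)
  h2_e p := (C.deg_deg i i p hi le_rfl hn).symm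
  g_e α p := C.conn_deg_self α i p hi hn
  h1_m x y h := C.deg_comp_le i i x y hi le_rfl hn h
  h2_m x y h := C.deg_comp_gt (i + 1) i x y hi (by omega) (by omega) hn h
  g_c1_g x := C.conn_comp_conn i x hi hn
  g_c2_g x := C.conn_comp_conn_succ i x hi hn
  g_false_m x y h := C.conn_minus_comp_self i x y hi hn h
  g_true_m x y h := C.conn_plus_comp_self i x y hi hn h

variable {C}

lemma isT_slice {n i : ℕ} (hi : 1 ≤ i) (hn : i ≤ n + 1) {A B : C.cell (n + 2)} :
    (C.slice n i hi hn).IsT A B ↔ C.IsTInverse i A B :=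
  ⟨fun h => ⟨h.1, h.2, h.3, h.4⟩, fun h => ⟨h.1, h.2, h.3, h.4⟩⟩

/-! ### Invertible cells -/

lemma IsRInverse.face {n i j : ℕ} (hi : 1 ≤ i) (hij : i ≤ j) (hj : j ≤ n + 1) (α : Bool)
    {A A' : C.cell (n + 2)} (h : C.IsRInverse i A A') :
    C.IsRInverse i (C.face α (j + 1) A) (C.face α (j + 1) A') := by
  obtain ⟨h1, h2, h3, h4⟩ := h
  have f : ∀ β X, C.face β i (C.face α (j + 1) X) = C.face α j (C.face β i X) :=
    fun β X => (C.face_face α β i j X hi hij hj).symm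
  refine ⟨by rw [f, f, h1], by rw [f, f, h2], ?_, ?_⟩
  · rw [← C.face_comp_gt α (j + 1) i A A' hi (by omega) (by omega) h1, h3,
      C.face_deg_gt α j i _ hi hij hj, f]
  · rw [← C.face_comp_gt α (j + 1) i A' A hi (by omega) (by omega) h2, h4,
      C.face_deg_gt α j i _ hi hij hj, f]

lemma IsRInverse.unique {n i : ℕ} (hi : 1 ≤ i) (hn : i ≤ n + 1) {A B B' : C.cell (n + 1)}
    (h : C.IsRInverse i A B) (h' : C.IsRInverse i A B') : B' = B := by
  rw [← C.comp_deg i B hi hn, h.2.1, ← h'.2.2.1, C.comp_assoc i _ _ _ hi hn h.2.1 h'.1, h.2.2.2, h'.1,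
    C.deg_comp_unit i _ hi hn]

lemma isRInvertible_deg_self {n i : ℕ} (hi : 1 ≤ i) (hn : i ≤ n + 1) (x : C.cell n) :
    C.IsRInvertible i (C.deg i x) := by
  have f := fun α => C.face_deg_self α i x hi hn
  have k : C.comp i (C.deg i x) (C.deg i x) = C.deg i x := by
    conv_lhs => rw [← f true]
    rw [f true]
    simpa [f true] using C.comp_deg i (C.deg i x) hi hn
  exact ⟨C.deg i x, by rw [f, f], by rw [f, f], by rw [k, f], by rw [k, f]⟩

lemma IsRInvertible.comp {n i j : ℕ} (hi : 1 ≤ i) (hij : i ≤ j) (hj : j ≤ n + 1)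
    {A B : C.cell (n + 2)} (hA : C.IsRInvertible i A) (hB : C.IsRInvertible i B)
    (h : C.face true (j + 1) A = C.face false (j + 1) B) :
    C.IsRInvertible i (C.comp (j + 1) A B) := by
  obtain ⟨A', hA⟩ := hA
  obtain ⟨B', hB⟩ := hB
  have h' : C.face true (j + 1) A' = C.face false (j + 1) B' :=
    (hB.face hi hij hj false).unique hi (by omega) (h ▸ hA.face hi hij hj true)
  obtain ⟨a1, a2, a3, a4⟩ := hA
  obtain ⟨b1, b2, b3, b4⟩ := hB
  have f := fun β X Y k => C.face_comp_lt β i j X Y hi hij hj k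
  have g : ∀ β, C.face true j (C.face β i A) = C.face false j (C.face β i B) := fun β => by
    rw [C.face_face _ _ _ _ _ hi hij hj, C.face_face _ _ _ _ _ hi hij hj, h]
  refine ⟨C.comp (j + 1) A' B', ?_, ?_, ?_, ?_⟩
  · rw [f _ _ _ h, f _ _ _ h', a1, b1]
  · rw [f _ _ _ h, f _ _ _ h', a2, b2]
  · rw [← C.comp_exchange i (j + 1) A A' B B' hi (by omega) (by omega) (by omega) (by omega) a1 b1 h h',
      a3, b3, f _ _ _ h, C.deg_comp_le i j _ _ hi hij hj (g _)]
  · rw [← C.comp_exchange i (j + 1) A' A B' B hi (by omega) (by omega) (by omega) (by omega) a2 b2 h' h,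
      a4, b4, f _ _ _ h, C.deg_comp_le i j _ _ hi hij hj (g _)]

lemma IsRInvertible.deg {n i j : ℕ} (hi : 1 ≤ i) (hij : i ≤ j) (hj : j ≤ n + 1)
    {A : C.cell (n + 1)} (hA : C.IsRInvertible i A) : C.IsRInvertible i (C.deg (j + 1) A) := by
  obtain ⟨A', h1, h2, h3, h4⟩ := hA
  have f := fun β X => C.face_deg_lt β i j X hi hij hj
  refine ⟨C.deg (j + 1) A', by rw [f, f, h1], by rw [f, f, h2], ?_, ?_⟩
  · rw [← C.deg_comp_gt (j + 1) i _ _ hi (by omega) (by omega) (by omega) h1, h3, f,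
      C.deg_deg i j _ hi hij hj]
  · rw [← C.deg_comp_gt (j + 1) i _ _ hi (by omega) (by omega) (by omega) h2, h4, f,
      C.deg_deg i j _ hi hij hj]

lemma IsRInverse.conn {n i j : ℕ} (hi : 1 ≤ i) (hij : i ≤ j) (hj : j ≤ n + 1) (β : Bool)
    {A A' : C.cell (n + 2)} (hA : C.IsRInverse i A A') :
    C.IsRInverse i (C.conn β (j + 1) A) (C.conn β (j + 1) A') := by
  obtain ⟨h1, h2, h3, h4⟩ := hA
  have f := fun α X => C.face_conn_lt α β i j X hi hij hj
  refine ⟨by rw [f, f, h1], by rw [f, f, h2], ?_, ?_⟩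
  · rw [← C.conn_comp_gt β (j + 1) i _ _ hi (by omega) (by omega) h1, h3, f,
      C.conn_deg_gt β j i _ hi hij hj]
  · rw [← C.conn_comp_gt β (j + 1) i _ _ hi (by omega) (by omega) h2, h4, f,
      C.conn_deg_gt β j i _ hi hij hj]

lemma IsRInvertible.conn {n i j : ℕ} (hi : 1 ≤ i) (hij : i ≤ j) (hj : j ≤ n + 1) (β : Bool)
    {A : C.cell (n + 2)} (hA : C.IsRInvertible i A) : C.IsRInvertible i (C.conn β (j + 1) A) := by
  obtain ⟨A', hA⟩ := hA
  exact ⟨_, hA.conn hi hij hj β⟩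

/-- A cell is invertible in a direction if its folding in two higher directions and its faces in these
directions are. -/
lemma isRInvertible_of_psi_gt {n i j : ℕ} (hi : 1 ≤ i) (hij : i ≤ j) (hj : j ≤ n + 1)
    {A : C.cell (n + 3)} (h : C.IsRInvertible i (C.psi (j + 1) A))
    (h1 : ∀ α, C.IsRInvertible i (C.face α (j + 1) A))
    (h2 : ∀ α, C.IsRInvertible i (C.face α (j + 2) A)) : C.IsRInvertible i A := by
  exact ConnDouble.of_psi (D := C.slice (n + 1) (j + 1) (by omega) (by omega)) (C.IsRInvertible i)
    (fun _ _ h hX hY => hX.comp hi hij (by omega) hY h)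
    (fun _ _ h hX hY => hX.comp hi (j := j + 1) (by omega) (by omega) hY h) h
    (fun α => (h1 α).deg hi hij (by omega)) (fun α β => (h2 α).conn hi hij (by omega) β)

/-! ### Faces and degeneracies of foldings -/

lemma psi_composable_left {n i : ℕ} (hi : 1 ≤ i) (hn : i ≤ n + 1) (A : C.cell (n + 2)) :
    C.face true (i + 1) (C.conn true i (C.face false (i + 1) A)) = C.face false (i + 1) A :=
  C.face_conn_same_succ true i _ hi hn

lemma psi_composable_right {n i : ℕ} (hi : 1 ≤ i) (hn : i ≤ n + 1) (A : C.cell (n + 2)) :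
    C.face true (i + 1) (C.comp (i + 1) (C.conn true i (C.face false (i + 1) A)) A) =
      C.face false (i + 1) (C.conn false i (C.face true (i + 1) A)) := by
  rw [C.face_comp_plus _ _ _ (by omega) (by omega) (psi_composable_left hi hn A),
    C.face_conn_same_succ _ _ _ hi hn]

lemma face_psi {n i j : ℕ} (hi : 1 ≤ i) (hij : i ≤ j) (hj : j ≤ n + 1) (α : Bool)
    (A : C.cell (n + 3)) : C.face α i (C.psi (j + 1) A) = C.psi j (C.face α i A) := by
  have f : ∀ β, C.face β (j + 1) (C.face α i A) = C.face α i (C.face β (j + 2) A) :=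
    fun β => C.face_face β α i (j + 1) A hi (by omega) (by omega)
  rw [psi, C.face_comp_lt α i (j + 1) _ _ hi (by omega) (by omega) (psi_composable_right (by omega) (by omega) A),
    C.face_comp_lt α i (j + 1) _ _ hi (by omega) (by omega) (psi_composable_left (by omega) (by omega) A),
    C.face_conn_lt α _ i j _ hi hij hj, C.face_conn_lt α _ i j _ hi hij hj, psi, f, f]

lemma psi_deg {n i j : ℕ} (hi : 1 ≤ i) (hij : i ≤ j) (hj : j ≤ n + 1)
    (A : C.cell (n + 2)) : C.psi (j + 1) (C.deg i A) = C.deg i (C.psi j A) := by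
  rw [psi, psi, C.deg_comp_le i (j + 1) _ _ hi (by omega) (by omega) (psi_composable_right (by omega) (by omega) A),
    C.deg_comp_le i (j + 1) _ _ hi (by omega) (by omega) (psi_composable_left (by omega) (by omega) A),
    C.face_deg_gt _ (j + 1) i _ hi (by omega) (by omega),
    C.face_deg_gt _ (j + 1) i _ hi (by omega) (by omega), C.conn_deg_gt _ j i _ hi hij hj,
    C.conn_deg_gt _ j i _ hi hij hj]

/-! ### Iterated foldings and invertibility of globular cells. -/

variable (C) in
/-- `foldChain m k A = ψ_m ψ_{m+1} ⋯ ψ_{m+k-1} A`. -/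
def foldChain {n : ℕ} : ℕ → ℕ → C.cell (n + 2) → C.cell (n + 2)
  | _, 0, A => A
  | m, k + 1, A => C.psi m (foldChain (m + 1) k A)

/-- `psiChain` peels off the innermost folding and `foldChain` the outermost one; the latter may
start at any index, as the inductions below need. -/
lemma psiChain_foldChain {n : ℕ} (m k : ℕ) (A : C.cell (n + 2)) :
    C.psiChain m (C.foldChain (m + 1) k A) = C.foldChain 1 (m + k) A := by
  induction m generalizing k with
  | zero => simp [psiChain]
  | succ m ih =>
    have := ih (k + 1)
    rw [foldChain] at this
    rw [psiChain, this]
    congr 1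
    omega

lemma face_foldChain {n i m k : ℕ} (hi : 1 ≤ i) (him : i ≤ m) (hm : m + k ≤ n + 2) (α : Bool)
    (A : C.cell (n + 3)) :
    C.face α i (C.foldChain (m + 1) k A) = C.foldChain m k (C.face α i A) := by
  induction k generalizing m with
  | zero => rfl
  | succ k ih =>
    rw [foldChain, face_psi hi him (by omega), ih (by omega) (by omega)]
    rfl

lemma foldChain_deg {n i m k : ℕ} (hi : 1 ≤ i) (him : i ≤ m) (hm : m + k ≤ n + 2)
    (A : C.cell (n + 2)) :
    C.foldChain (m + 1) k (C.deg i A) = C.deg i (C.foldChain m k A) := by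
  induction k generalizing m with
  | zero => rfl
  | succ k ih =>
    rw [foldChain, ih (by omega) (by omega), psi_deg hi him (by omega)]
    rfl

/-- Induction on `m`: dropping the outermost folding `ψ_{m+1}` raises the direction of invertibility
by one, by `exists_isR2_of_psi`. The faces required there, in direction `m + 1`, are iterated
foldings of faces of `A`, covered by the induction hypothesis one dimension lower. -/
lemma isRInvertible_foldChain (hC : C.IsOmegaP 1) {n m k : ℕ} (h : m + k = n) (A : C.cell (n + 2)) :
    C.IsRInvertible (m + 1) (C.foldChain (m + 1) (k + 1) A) := by
  induction m generalizing n k with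
  | zero =>
    have h1 : C.IsRInvertible 1 (C.psiChain (n + 1) A) := hC (n + 1) (by omega) A
    have h2 := psiChain_foldChain (n + 1) 0 A
    rw [foldChain] at h2
    rw [h2] at h1
    obtain rfl : k = n := by omega
    exact h1
  | succ m ih =>
    obtain ⟨n, rfl⟩ : ∃ n', n = n' + 1 := ⟨n - 1, by omega⟩
    have h0 := ih (k := k + 1) (by omega) A
    refine ConnDouble.exists_isR2_of_psi (D := C.slice (n + 1) (m + 1) (by omega) (by omega)) h0 ?_
    intro α
    have h1 := ih (n := n) (k := k) (by omega) (C.face α (m + 1) A)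
    rw [← face_foldChain (by omega) (by omega) (by omega)] at h1
    exact h1

/-- The faces of `A` in direction `i + 1` are degenerate in direction `i`. -/
def IsGlobular {n : ℕ} (i : ℕ) (A : C.cell (n + 2)) : Prop :=
  ∀ α, ∃ p, C.face α (i + 1) A = C.deg i p

lemma isGlobular_psi {n i : ℕ} (hi : 1 ≤ i) (hn : i ≤ n + 1) (A : C.cell (n + 2)) :
    IsGlobular i (C.psi i A) := by
  rintro (_ | _)
  · exact ⟨_, ConnDouble.d2_psi_false (C.slice n i hi hn) A⟩
  · exact ⟨_, ConnDouble.d2_psi_true (C.slice n i hi hn) A⟩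

lemma IsGlobular.face {n i l : ℕ} (hi : 1 ≤ i) (hil : i + 1 ≤ l) (hl : l ≤ n + 2) {A : C.cell (n + 3)}
    (h : IsGlobular i A) (α : Bool) : IsGlobular i (C.face α (l + 1) A) := by
  intro β
  obtain ⟨p, hp⟩ := h β
  obtain ⟨l, rfl⟩ : ∃ l', l = l' + 1 := ⟨l - 1, by omega⟩
  refine ⟨C.face α l p, ?_⟩
  rw [← C.face_face α β (i + 1) (l + 1) A (by omega) hil hl, hp,
    C.face_deg_gt α l i p hi (by omega) (by omega)]

lemma IsGlobular.foldChain {n i m k : ℕ} (hi : 1 ≤ i) (him : i + 1 ≤ m) (hm : m + k ≤ n + 2)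
    {A : C.cell (n + 3)} (h : IsGlobular i A) : IsGlobular i (C.foldChain (m + 1) k A) := by
  intro α
  obtain ⟨p, hp⟩ := h α
  obtain ⟨m, rfl⟩ : ∃ m', m = m' + 1 := ⟨m - 1, by omega⟩
  rw [face_foldChain (by omega) (by omega) hm, hp]
  obtain _ | k := k
  · exact ⟨p, rfl⟩
  · obtain ⟨n, rfl⟩ : ∃ n', n = n' + 1 := ⟨n - 1, by omega⟩
    exact ⟨_, foldChain_deg hi (by omega) (by omega) p⟩

/-- Starting from the invertible cell `ψ_i ⋯ ψ_{n+1} A`, the foldings are removed from the outside.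
Each removal needs certain faces to be `R_i`-invertible: in direction `i + 1` they are degenerate,
and in higher directions they are globular of lower dimension. -/
lemma IsGlobular.isRInvertible (hC : C.IsOmegaP 1) {n i : ℕ} (hi : 1 ≤ i) (hn : i ≤ n + 1)
    {A : C.cell (n + 2)} (hA : IsGlobular i A) : C.IsRInvertible i A := by
  induction n with
  | zero =>
    obtain rfl : i = 1 := by omega
    refine ConnDouble.exists_isR1_of_psi (D := C.slice 0 1 le_rfl le_rfl)
      (isRInvertible_foldChain hC (m := 0) (k := 0) rfl A) fun α => ?_
    obtain ⟨p, hp⟩ := hA α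
    have := isRInvertible_deg_self (C := C) hi le_rfl p
    rw [← hp] at this
    exact this
  | succ n ih =>
    have hface : ∀ {V : C.cell (n + 3)}, IsGlobular i V → ∀ l, i ≤ l → l ≤ n + 2 → ∀ α,
        C.IsRInvertible i (C.face α (l + 1) V) := by
      intro V hV l hil hl α
      obtain rfl | hil := hil.eq_or_lt
      · obtain ⟨p, hp⟩ := hV α
        rw [hp]
        exact isRInvertible_deg_self hi (by omega) p
      · exact ih (by omega) (hV.face hi hil hl α)
    obtain ⟨k, hk⟩ : ∃ k, i + k = n + 2 := ⟨n + 2 - i, by omega⟩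
    -- Stage `l` has lost `ψ_i, …, ψ_{i+l}`; at `r = 0` only `A` is left.
    suffices h : ∀ l r, l + r = k → C.IsRInvertible i (C.foldChain (i + l + 1) r A) from h k 0 rfl
    intro l
    induction l with
    | zero =>
      intro r hr
      have h0 := isRInvertible_foldChain hC (m := i - 1) (k := r) (by omega) A
      rw [Nat.sub_add_cancel hi] at h0
      refine ConnDouble.exists_isR1_of_psi (D := C.slice (n + 1) i hi hn) h0 fun α => ?_
      change C.IsRInvertible i (C.face α (i + 1) (C.foldChain (i + 1) r A))
      obtain _ | r := r
      · exact hface hA i le_rfl (by omega) α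
      · have hV : IsGlobular i (C.foldChain (i + 1 + 1) r A) :=
          hA.foldChain hi le_rfl (by omega)
        -- The outer `ψ_{i+1}` spoils globularity: its faces in direction `i + 1` are composites of
        -- faces in directions `i + 1` and `i + 2`, each of which is invertible.
        rw [CubicalOmegaCat.foldChain]
        have hf := (C.slice (n + 1) (i + 1) (by omega) (by omega)).s_d2
        cases α
        · refine (congrArg (C.IsRInvertible i) (ConnDouble.d1_psi_false
            (C.slice (n + 1) (i + 1) (by omega) (by omega)) _)).mpr ?_
          exact (hface hV i le_rfl (by omega) _).comp hi le_rfl (by omega)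
            (hface hV (i + 1) (by omega) (by omega) _) (hf _ _ _).symm
        · refine (congrArg (C.IsRInvertible i) (ConnDouble.d1_psi_true
            (C.slice (n + 1) (i + 1) (by omega) (by omega)) _)).mpr ?_
          exact (hface hV (i + 1) (by omega) (by omega) _).comp hi le_rfl (by omega)
            (hface hV i le_rfl (by omega) _) (hf _ _ _)
    | succ l ihl =>
      intro r hr
      have hV : IsGlobular i (C.foldChain (i + l + 1 + 1) r A) :=
        hA.foldChain hi (by omega) (by omega)
      exact isRInvertible_of_psi_gt hi (j := i + l) (by omega) (by omega) (ihl (r + 1) (by omega))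
        (hface hV (i + l) (by omega) (by omega)) (hface hV (i + l + 1) (by omega) (by omega))

/-- In a cubical `(ω, 1)`-category all `T_i`-inverses exist. -/
lemma exists_isTInverse (hC : C.IsOmegaP 1) {n i : ℕ} (hi : 1 ≤ i) (hn : i ≤ n + 1)
    (A : C.cell (n + 2)) : ∃ B, C.IsTInverse i A B := by
  obtain ⟨B, hB⟩ := ConnDouble.exists_isT (D := C.slice n i hi hn) (A := A)
    ((isGlobular_psi hi hn A).isRInvertible hC hi hn)
  exact ⟨B, isT_slice hi hn |>.1 hB⟩

lemma IsTInverse.unique {n i : ℕ} (hi : 1 ≤ i) (hn : i ≤ n + 1) {A B B' : C.cell (n + 2)}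
    (h : C.IsTInverse i A B) (h' : C.IsTInverse i A B') : B' = B :=
  ((isT_slice hi hn).2 h).unique ((isT_slice hi hn).2 h')

end CubicalOmegaCat

/-! ### The maps `T_i` and the axioms that follow from uniqueness. -/

namespace CubicalOmegaCat
variable {C : CubicalOmegaCat.{u}}

open Classical in
/-- The `T_i`-inverse of a cell of a cubical `(ω, 1)`-category. -/
noncomputable def T (hC : C.IsOmegaP 1) {n : ℕ} (i : ℕ) (A : C.cell (n + 2)) : C.cell (n + 2) :=
  if h : 1 ≤ i ∧ i ≤ n + 1 then (exists_isTInverse hC h.1 h.2 A).choose else A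

variable (hC : C.IsOmegaP 1)

lemma isTInverse_T {n i : ℕ} (hi : 1 ≤ i) (hn : i ≤ n + 1) (A : C.cell (n + 2)) :
    C.IsTInverse i A (T hC i A) := by
  rw [T, dif_pos ⟨hi, hn⟩]
  exact (exists_isTInverse hC hi hn A).choose_spec

lemma isT_T {n i : ℕ} (hi : 1 ≤ i) (hn : i ≤ n + 1) (A : C.cell (n + 2)) :
    (C.slice n i hi hn).IsT A (T hC i A) :=
  (isT_slice hi hn).2 (isTInverse_T hC hi hn A)

/-- Uniqueness reduces a formula for `T_i` to exhibiting a transposed pair. -/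
lemma T_eq {n i : ℕ} (hi : 1 ≤ i) (hn : i ≤ n + 1) {A B : C.cell (n + 2)}
    (h : (C.slice n i hi hn).IsT A B) : T hC i A = B :=
  h.unique (isT_T hC hi hn A)

lemma face_T_self {n : ℕ} (α : Bool) (j : ℕ) (A : C.cell (n + 2)) (hj : 1 ≤ j) (hn : j ≤ n + 1) :
    C.face α j (T hC j A) = C.face α (j + 1) A :=
  ((isTInverse_T hC hj hn A).face_right α).symm

lemma face_T_succ {n : ℕ} (α : Bool) (j : ℕ) (A : C.cell (n + 2)) (hj : 1 ≤ j) (hn : j ≤ n + 1) :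
    C.face α (j + 1) (T hC j A) = C.face α j A :=
  ((isTInverse_T hC hj hn A).face_left α).symm

/-- Maps that respect the directions `i`, `i + 1` commute with transposition. -/
lemma T_map {n n' i i' : ℕ} (hi : 1 ≤ i) (hn : i ≤ n + 1) (hi' : 1 ≤ i') (hn' : i' ≤ n' + 1)
    (F : C.cell (n + 2) → C.cell (n' + 2)) (G : C.cell (n + 1) → C.cell (n' + 1))
    (hd1 : ∀ β A, C.face β i' (F A) = G (C.face β i A))
    (hd2 : ∀ β A, C.face β (i' + 1) (F A) = G (C.face β (i + 1) A))
    (hg : ∀ β x, F (C.conn β i x) = C.conn β i' (G x))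
    (hc1 : ∀ A B, C.face true i A = C.face false i B →
      F (C.comp i A B) = C.comp i' (F A) (F B))
    (hc2 : ∀ A B, C.face true (i + 1) A = C.face false (i + 1) B →
      F (C.comp (i + 1) A B) = C.comp (i' + 1) (F A) (F B)) (A : C.cell (n + 2)) :
    T hC i' (F A) = F (T hC i A) :=
  T_eq hC hi' hn' ((isT_T hC hi hn A).map (D' := C.slice n' i' hi' hn') F G hd1 hd2 hg hc1 hc2)

lemma face_T_lt {n : ℕ} (α : Bool) (i j : ℕ) (A : C.cell (n + 3)) (hi : 1 ≤ i) (hij : i ≤ j)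
    (hj : j ≤ n + 1) : C.face α i (T hC (j + 1) A) = T hC j (C.face α i A) :=
  (T_map hC (i := j + 1) (i' := j) (by omega) (by omega) (by omega) hj
    (C.face α i) (C.face α i)
    (fun β A => C.face_face β α i j A hi hij (by omega))
    (fun β A => C.face_face β α i (j + 1) A hi (by omega) (by omega))
    (fun β x => C.face_conn_lt α β i j x hi hij hj)
    (fun A B h => C.face_comp_lt α i j A B hi hij (by omega) h)
    (fun A B h => C.face_comp_lt α i (j + 1) A B hi (by omega) (by omega) h) A).symm

lemma face_T_gt {n : ℕ} (α : Bool) (i j : ℕ) (A : C.cell (n + 3)) (hj : 1 ≤ j) (hij : j + 1 < i)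
    (hi : i ≤ n + 3) : C.face α i (T hC j A) = T hC j (C.face α i A) := by
  obtain ⟨i, rfl⟩ : ∃ i', i = i' + 1 := ⟨i - 1, by omega⟩
  exact (T_map hC (i := j) (i' := j) hj (by omega) hj (by omega)
    (C.face α (i + 1)) (C.face α i)
    (fun β A => (C.face_face α β j i A hj (by omega) (by omega)).symm)
    (fun β A => (C.face_face α β (j + 1) i A (by omega) (by omega) (by omega)).symm)
    (fun β x => C.face_conn_gt α β i j x hj (by omega) (by omega))
    (fun A B h => C.face_comp_gt α (i + 1) j A B hj (by omega) (by omega) h)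
    (fun A B h => C.face_comp_gt α (i + 1) (j + 1) A B (by omega) (by omega) (by omega) h) A).symm

lemma T_deg_self {n : ℕ} (j : ℕ) (A : C.cell (n + 1)) (hj : 1 ≤ j) (hn : j ≤ n + 1) :
    T hC j (C.deg j A) = C.deg (j + 1) A :=
  T_eq hC hj hn (ConnDouble.isT_h1 (D := C.slice n j hj hn) A)

lemma T_deg_succ {n : ℕ} (j : ℕ) (A : C.cell (n + 1)) (hj : 1 ≤ j) (hn : j ≤ n + 1) :
    T hC j (C.deg (j + 1) A) = C.deg j A :=
  T_eq hC hj hn (ConnDouble.isT_h1 (D := C.slice n j hj hn) A).symm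

lemma T_conn_self {n : ℕ} (α : Bool) (j : ℕ) (A : C.cell (n + 1)) (hj : 1 ≤ j) (hn : j ≤ n + 1) :
    T hC j (C.conn α j A) = C.conn α j A :=
  T_eq hC hj hn (ConnDouble.isT_g (D := C.slice n j hj hn) α A)

lemma T_T {n : ℕ} (i : ℕ) (A : C.cell (n + 2)) (hi : 1 ≤ i) (hn : i ≤ n + 1) :
    T hC i (T hC i A) = A :=
  T_eq hC hi hn (isT_T hC hi hn A).symm

lemma T_deg_lt {n : ℕ} (i j : ℕ) (A : C.cell (n + 2)) (hi : 1 ≤ i) (hij : i + 1 < j)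
    (hj : j ≤ n + 3) : T hC i (C.deg j A) = C.deg j (T hC i A) := by
  obtain ⟨j, rfl⟩ : ∃ j', j = j' + 1 := ⟨j - 1, by omega⟩
  exact T_map hC (i := i) (i' := i) hi (by omega) hi (by omega)
    (C.deg (j + 1)) (C.deg j)
    (fun β A => C.face_deg_lt β i j A hi (by omega) (by omega))
    (fun β A => C.face_deg_lt β (i + 1) j A (by omega) (by omega) (by omega))
    (fun β x => (C.conn_deg_lt β i j x hi (by omega) (by omega)).symm)
    (fun A B h => C.deg_comp_gt (j + 1) i A B hi (by omega) (by omega) (by omega) h)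
    (fun A B h => C.deg_comp_gt (j + 1) (i + 1) A B (by omega) (by omega) (by omega) (by omega) h) A

lemma T_deg_ge {n : ℕ} (i j : ℕ) (A : C.cell (n + 2)) (hj : 1 ≤ j) (hij : j ≤ i) (hi : i ≤ n + 1) :
    T hC (i + 1) (C.deg j A) = C.deg j (T hC i A) :=
  T_map hC (i := i) (i' := i + 1) (by omega) (by omega) (by omega) (by omega)
    (C.deg j) (C.deg j)
    (fun β A => C.face_deg_gt β i j A hj hij (by omega))
    (fun β A => C.face_deg_gt β (i + 1) j A hj (by omega) (by omega))
    (fun β x => (C.conn_deg_gt β i j x hj hij hi).symm)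
    (fun A B h => C.deg_comp_le j i A B hj hij (by omega) h)
    (fun A B h => C.deg_comp_le j (i + 1) A B hj (by omega) (by omega) h) A

lemma T_conn_lt {n : ℕ} (α : Bool) (i j : ℕ) (A : C.cell (n + 2)) (hi : 1 ≤ i) (hij : i + 1 < j)
    (hj : j ≤ n + 2) : T hC i (C.conn α j A) = C.conn α j (T hC i A) := by
  obtain ⟨j, rfl⟩ : ∃ j', j = j' + 1 := ⟨j - 1, by omega⟩
  exact T_map hC (i := i) (i' := i) hi (by omega) hi (by omega)
    (C.conn α (j + 1)) (C.conn α j)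
    (fun β A => C.face_conn_lt β α i j A hi (by omega) (by omega))
    (fun β A => C.face_conn_lt β α (i + 1) j A (by omega) (by omega) (by omega))
    (fun β x => (C.conn_conn_lt β α i j x hi (by omega) (by omega)).symm)
    (fun A B h => C.conn_comp_gt α (j + 1) i A B hi (by omega) (by omega) h)
    (fun A B h => C.conn_comp_gt α (j + 1) (i + 1) A B (by omega) (by omega) (by omega) h) A

lemma T_conn_gt {n : ℕ} (α : Bool) (i j : ℕ) (A : C.cell (n + 2)) (hj : 1 ≤ j) (hij : j < i)
    (hi : i ≤ n + 1) : T hC (i + 1) (C.conn α j A) = C.conn α j (T hC i A) :=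
  T_map hC (i := i) (i' := i + 1) (by omega) (by omega) (by omega) (by omega)
    (C.conn α j) (C.conn α j)
    (fun β A => C.face_conn_gt β α i j A hj hij (by omega))
    (fun β A => C.face_conn_gt β α (i + 1) j A hj (by omega) (by omega))
    (fun β x => C.conn_conn_lt α β j i x hj hij hi)
    (fun A B h => C.conn_comp_lt α j i A B hj hij (by omega) h)
    (fun A B h => C.conn_comp_lt α j (i + 1) A B hj (by omega) (by omega) h) A

lemma T_comp_self {n : ℕ} (i : ℕ) (A B : C.cell (n + 2)) (hi : 1 ≤ i) (hn : i ≤ n + 1)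
    (h : C.face true i A = C.face false i B) :
    T hC i (C.comp i A B) = C.comp (i + 1) (T hC i A) (T hC i B) :=
  T_eq hC hi hn ((isT_T hC hi hn A).c1 (isT_T hC hi hn B) h)

lemma T_comp_succ {n : ℕ} (i : ℕ) (A B : C.cell (n + 2)) (hi : 1 ≤ i) (hn : i ≤ n + 1)
    (h : C.face true (i + 1) A = C.face false (i + 1) B) :
    T hC i (C.comp (i + 1) A B) = C.comp i (T hC i A) (T hC i B) :=
  T_eq hC hi hn ((isT_T hC hi hn A).c2 (isT_T hC hi hn B) h)

/-- Composition in a third direction is a partial operation commuting with the double structure in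
directions `i`, `i + 1`, so `IsT.map₂` applies; the index shifts differ for `j < i` and `j > i + 1`.
-/
lemma T_comp_other {n : ℕ} (i j : ℕ) (A B : C.cell (n + 2)) (hi : 1 ≤ i) (hn : i ≤ n + 1)
    (hj : 1 ≤ j) (hjn : j ≤ n + 2) (h1 : j ≠ i) (h2 : j ≠ i + 1)
    (h : C.face true j A = C.face false j B) :
    T hC i (C.comp j A B) = C.comp j (T hC i A) (T hC i B) := by
  obtain ⟨n, rfl⟩ : ∃ n', n = n' + 1 := ⟨n - 1, by omega⟩
  obtain hji | hij := h1.lt_or_gt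
  · obtain ⟨i, rfl⟩ : ∃ i', i = i' + 1 := ⟨i - 1, by omega⟩
    have f : ∀ l, j ≤ l → l ≤ n + 2 → ∀ α β (X : C.cell (n + 3)),
        C.face β j (C.face α (l + 1) X) = C.face α l (C.face β j X) :=
      fun l hl hl' α β X => (C.face_face α β j l X hj hl hl').symm
    refine T_eq hC hi hn <| (isT_T hC hi hn A).map₂ (fun X Y => C.face true j X = C.face false j Y)
      (fun x y => C.face true j x = C.face false j y) (C.comp j) (C.comp j) ?_ ?_ ?_ ?_ ?_
      (isT_T hC hi hn B) h ?_
    · exact fun α X Y hXY => ⟨(f i (by omega) (by omega) _ _ _).trans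
        ((congrArg _ hXY).trans (f i (by omega) (by omega) _ _ _).symm),
        C.face_comp_gt α (i + 1) j X Y hj hji (by omega) hXY⟩
    · exact fun α X Y hXY => ⟨(f (i + 1) (by omega) (by omega) _ _ _).trans
        ((congrArg _ hXY).trans (f (i + 1) (by omega) (by omega) _ _ _).symm),
        C.face_comp_gt α (i + 2) j X Y hj (by omega) (by omega) hXY⟩
    · exact fun α x y hxy => ⟨(C.face_conn_lt true α j i x hj (by omega) (by omega)).trans
        ((congrArg _ hxy).trans (C.face_conn_lt false α j i y hj (by omega) (by omega)).symm),
        (C.conn_comp_gt α (i + 1) j x y hj hji (by omega) hxy).symm⟩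
    · exact fun X Y X' Y' hXY hXY' hX hY => ⟨(C.face_comp_lt true j i X X' hj (by omega) (by omega)
        hX).trans ((congrArg₂ _ hXY hXY').trans
          (C.face_comp_lt false j i Y Y' hj (by omega) (by omega) hY).symm),
        C.comp_exchange (i + 1) j X X' Y Y' hi (by omega) hj (by omega) (by omega) hX hY hXY hXY'⟩
    · exact fun X Y X' Y' hXY hXY' hX hY =>
        C.comp_exchange (i + 2) j X X' Y Y' (by omega) (by omega) hj (by omega) (by omega) hX hY hXY hXY'
    · change C.face true j (T hC (i + 1) A) = C.face false j (T hC (i + 1) B)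
      rw [face_T_lt hC _ _ _ _ hj (by omega) (by omega), h,
        face_T_lt hC _ _ _ _ hj (by omega) (by omega)]
  · obtain ⟨j, rfl⟩ : ∃ j', j = j' + 1 := ⟨j - 1, by omega⟩
    have f : ∀ l, 1 ≤ l → l ≤ j → ∀ α β (X : C.cell (n + 3)),
        C.face β j (C.face α l X) = C.face α l (C.face β (j + 1) X) :=
      fun l hl hl' α β X => C.face_face β α l j X hl hl' (by omega)
    refine T_eq hC hi hn <| (isT_T hC hi hn A).map₂
      (fun X Y => C.face true (j + 1) X = C.face false (j + 1) Y)
      (fun x y => C.face true j x = C.face false j y) (C.comp (j + 1)) (C.comp j) ?_ ?_ ?_ ?_ ?_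
      (isT_T hC hi hn B) h ?_
    · exact fun α X Y hXY => ⟨(f i (by omega) (by omega) _ _ _).trans
        ((congrArg _ hXY).trans (f i (by omega) (by omega) _ _ _).symm),
        C.face_comp_lt α i j X Y hi (by omega) (by omega) hXY⟩
    · exact fun α X Y hXY => ⟨(f (i + 1) (by omega) (by omega) _ _ _).trans
        ((congrArg _ hXY).trans (f (i + 1) (by omega) (by omega) _ _ _).symm),
        C.face_comp_lt α (i + 1) j X Y (by omega) (by omega) (by omega) hXY⟩
    · exact fun α x y hxy => ⟨(C.face_conn_gt true α j i x hi (by omega) (by omega)).trans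
        ((congrArg _ hxy).trans (C.face_conn_gt false α j i y hi (by omega) (by omega)).symm),
        (C.conn_comp_lt α i j x y hi (by omega) (by omega) hxy).symm⟩
    · exact fun X Y X' Y' hXY hXY' hX hY => ⟨(C.face_comp_gt true (j + 1) i X X' hi (by omega) (by omega)
        hX).trans ((congrArg₂ _ hXY hXY').trans
          (C.face_comp_gt false (j + 1) i Y Y' hi (by omega) (by omega) hY).symm),
        C.comp_exchange i (j + 1) X X' Y Y' hi (by omega) hj (by omega) (by omega) hX hY hXY hXY'⟩
    · exact fun X Y X' Y' hXY hXY' hX hY => C.comp_exchange (i + 1) (j + 1) X X' Y Y' (by omega)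
        (by omega) hj (by omega) (by omega) hX hY hXY hXY'
    · change C.face true (j + 1) (T hC i A) = C.face false (j + 1) (T hC i B)
      rw [face_T_gt hC _ _ _ _ hi (by omega) (by omega), h,
        face_T_gt hC _ _ _ _ hi (by omega) (by omega)]

/-- By the axioms already shown, `T_j` itself respects the double structure in the distant
directions `i`, `i + 1`. -/
lemma T_comm {n : ℕ} (i j : ℕ) (A : C.cell (n + 2)) (hi : 1 ≤ i) (hij : i + 2 ≤ j) (hj : j ≤ n + 1) :
    T hC i (T hC j A) = T hC j (T hC i A) := by
  obtain ⟨n, rfl⟩ : ∃ n', n = n' + 1 := ⟨n - 1, by omega⟩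
  obtain ⟨j, rfl⟩ : ∃ j', j = j' + 1 := ⟨j - 1, by omega⟩
  exact T_map hC (i := i) (i' := i) hi (by omega) hi (by omega)
    (T hC (j + 1)) (T hC j)
    (fun β A => face_T_lt hC β i j A hi (by omega) (by omega))
    (fun β A => face_T_lt hC β (i + 1) j A (by omega) (by omega) (by omega))
    (fun β x => T_conn_gt hC β j i x hi (by omega) (by omega))
    (fun A B h => T_comp_other hC (j + 1) i A B (by omega) hj hi (by omega) (by omega) (by omega) h)
    (fun A B h => T_comp_other hC (j + 1) (i + 1) A B (by omega) hj (by omega) (by omega) (by omega)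
      (by omega) h) A

end CubicalOmegaCat

/-! ### Adjacent connections and the braid relation. -/

namespace CubicalOmegaCat
variable {C : CubicalOmegaCat.{u}} (hC : C.IsOmegaP 1)

section ConnComp

variable {n i : ℕ} (hi : 1 ≤ i) (hn : i ≤ n + 1) (v : C.cell (n + 1))

include hi hn

/-- Composite of the two connections in the middle direction. -/
lemma comp_deg_conn_conn :
    C.comp i (C.deg (i + 1) (C.conn true i v)) (C.conn true i (C.conn false i v)) =
      C.conn false (i + 1) (C.conn true i v) := by
  have hv : C.face true i (C.conn true i v) = C.face false i (C.conn false i v) := by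
    rw [C.face_conn_same true i v hi hn, C.face_conn_same false i v hi hn]
  have hL : C.face true i (C.deg (i + 1) (C.conn true i v)) =
      C.face false i (C.conn true i (C.conn false i v)) := by
    rw [C.face_deg_lt true i i _ hi le_rfl (by omega), hv]
    exact (C.face_conn_opp false i _ hi (by omega)).symm
  refine ConnDouble.eq_g_false (D := C.slice (n + 1) (i + 1) (by omega) (by omega)) (p := v) ?_ ?_ ?_
  · change C.face false (i + 1) (C.comp i _ _) = _
    rw [C.face_comp_gt _ _ _ _ _ hi (by omega) (by omega) hL,
      C.face_deg_self _ _ _ (by omega) (by omega)]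
    have := C.face_conn_opp_succ false i (C.conn false i v) hi (by omega)
    rw [Bool.not_false] at this
    rw [this, ← hv, C.comp_deg _ _ hi (by omega)]
  · change C.face true (i + 2) (C.comp i _ _) = C.deg (i + 1) v
    rw [C.face_comp_gt _ _ _ _ _ hi (by omega) (by omega) hL,
      C.face_deg_gt _ (i + 1) (i + 1) _ (by omega) le_rfl (by omega),
      C.face_conn_same_succ true i v hi hn, C.face_conn_gt _ _ (i + 1) i _ hi (by omega) (by omega)]
    have := C.face_conn_opp_succ true i v hi hn
    rw [Bool.not_true] at this
    rw [this, C.conn_deg_self _ _ _ hi hn, ← C.face_deg_lt true i i _ hi le_rfl hn,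
      C.comp_deg _ _ hi (by omega)]
  -- As `Γ_{i+1}^+ Γ_i^+ v = Γ_i^+ Γ_i^+ v`, the composite is `Γ_i^+` of `Γ_i^+ v ⋆_i Γ_i^- v =
  -- ε_{i+1} v`.
  · have h := ConnDouble.g_true_m_unit (D := C.slice (n + 1) i hi (by omega)) hv
    change C.comp (i + 1) (C.conn true (i + 1) (C.conn true i v)) (C.comp i _ _) =
      C.deg (i + 2) (C.conn true i v)
    rw [C.conn_conn_self true i v hi hn]
    refine h.trans ?_
    change C.conn true i (C.comp i _ _) = _
    rw [C.conn_comp_conn _ _ hi hn, C.conn_deg_lt true i (i + 1) v hi (by omega) (by omega)]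

/-- The other bracketing of the same formula for `Γ_i^+(Γ_i^+ v ⋆_i Γ_i^- v)`, transposed by
`T_{i+1}`, is the equation characterising `Γ_i^-` through its composite with `Γ_i^+`. -/
lemma T_comp_deg_conn_conn :
    T hC (i + 1) (C.comp (i + 1) (C.deg i (C.conn true i v)) (C.conn true i (C.conn false i v))) =
      C.conn false i (C.conn true i v) := by
  have hv : C.face true i (C.conn true i v) = C.face false i (C.conn false i v) := by
    rw [C.face_conn_same true i v hi hn, C.face_conn_same false i v hi hn]
  have hK : C.face true (i + 1) (C.deg i (C.conn true i v)) =
      C.face false (i + 1) (C.conn true i (C.conn false i v)) := by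
    rw [C.face_deg_gt true i i _ hi le_rfl (by omega), hv]
    exact (C.face_conn_opp_succ false i _ hi (by omega)).symm
  have hKf : C.face false i (C.comp (i + 1) (C.deg i (C.conn true i v))
      (C.conn true i (C.conn false i v))) = C.conn true i v := by
    rw [C.face_comp_lt _ _ _ _ _ hi le_rfl (by omega) hK,
      C.face_deg_self _ _ _ (by omega) (by omega)]
    have := C.face_conn_opp false i (C.conn false i v) hi (by omega)
    rw [Bool.not_false] at this
    rw [this, ← hv, C.comp_deg _ _ hi (by omega)]
  refine ConnDouble.eq_g_false (D := C.slice (n + 1) i (by omega) (by omega)) (p := v) ?_ ?_ ?_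
  · change C.face false i (T hC (i + 1) _) = _
    rw [face_T_lt hC _ _ _ _ hi le_rfl (by omega), hKf, T_conn_self hC _ _ _ hi hn]
  · change C.face true (i + 1) (T hC (i + 1) _) = C.deg i v
    rw [face_T_self hC _ _ _ (by omega) (by omega),
      C.face_comp_gt _ (i + 2) (i + 1) _ _ (by omega) (by omega) (by omega) hK,
      C.face_deg_gt _ (i + 1) i _ hi (by omega) (by omega),
      C.face_conn_same_succ true i v hi hn, C.face_conn_gt _ _ (i + 1) i _ hi (by omega) (by omega)]
    have := C.face_conn_opp_succ true i v hi hn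
    rw [Bool.not_true] at this
    rw [this, C.conn_deg_self _ _ _ hi hn, C.deg_deg _ _ _ hi le_rfl hn,
      ← C.face_deg_gt true i i _ hi le_rfl hn, C.comp_deg _ _ (by omega) (by omega)]
  · have h := ConnDouble.g_true_m_unit' (D := C.slice (n + 1) i hi (by omega)) hv
    replace h : C.comp i (C.conn true i (C.conn true i v)) (C.comp (i + 1) (C.deg i (C.conn true i v))
        (C.conn true i (C.conn false i v))) = C.conn true i (C.comp i _ _) := h
    rw [C.conn_comp_conn _ _ hi hn, C.conn_deg_lt true i (i + 1) v hi (by omega) (by omega)] at h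
    replace h := congrArg (T hC (i + 1)) h
    rw [T_deg_succ hC _ _ (by omega) (by omega), T_comp_other hC _ _ _ _ (by omega) (by omega) hi
      (by omega) (by omega) (by omega), ← C.conn_conn_self true i v hi hn,
      T_conn_self hC _ _ _ (by omega) (by omega), C.conn_conn_self true i v hi hn] at h
    · exact h
    · rw [hKf, C.face_conn_same _ _ _ hi (by omega)]

/-- The two preceding composites are exchanged by `T_i`, which swaps `ε_i` with `ε_{i+1}` and `⋆_i`
with `⋆_{i+1}` and fixes `Γ_i^+ Γ_i^- v`. -/
lemma T_T_conn_conn_true :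
    T hC i (T hC (i + 1) (C.conn false i (C.conn true i v))) =
      C.conn false (i + 1) (T hC i (C.conn true i v)) := by
  rw [T_conn_self hC _ _ _ hi hn, ← T_comp_deg_conn_conn hC hi hn, T_T hC _ _ (by omega) (by omega),
    ← comp_deg_conn_conn hi hn]
  have := T_comp_self hC i (C.deg (i + 1) (C.conn true i v)) (C.conn true i (C.conn false i v)) hi
    (by omega) ?_
  · rw [T_deg_succ hC _ _ hi (by omega), T_conn_self hC _ _ _ hi (by omega)] at this
    rw [← this, T_T hC _ _ hi (by omega)]
  · have hv : C.face true i (C.conn true i v) = C.face false i (C.conn false i v) := by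
      rw [C.face_conn_same true i v hi hn, C.face_conn_same false i v hi hn]
    rw [C.face_deg_lt true i i _ hi le_rfl (by omega), hv]
    exact (C.face_conn_opp false i _ hi (by omega)).symm

end ConnComp

section

variable {n i : ℕ} (hi : 1 ≤ i) (hn : i ≤ n + 1)

include hi hn

/-- `T_i T_{i+1}` carries the 2×2 formula for `Γ_i^-(X ⋆_i Y)` entry by entry to the one for
`Γ_{i+1}^-(T_i X ⋆_{i+1} T_i Y)`. -/
lemma T_T_conn_comp_self {X Y : C.cell (n + 2)} (h : C.face true i X = C.face false i Y)
    (hX : T hC i (T hC (i + 1) (C.conn false i X)) = C.conn false (i + 1) (T hC i X))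
    (hY : T hC i (T hC (i + 1) (C.conn false i Y)) = C.conn false (i + 1) (T hC i Y)) :
    T hC i (T hC (i + 1) (C.conn false i (C.comp i X Y))) =
      C.conn false (i + 1) (T hC i (C.comp i X Y)) := by
  have k1 : C.face true i (C.conn false i X) = C.face false i (C.deg (i + 1) Y) := by
    rw [C.face_deg_lt false i i _ hi le_rfl (by omega), ← h]
    exact C.face_conn_opp true i _ hi (by omega)
  have k2 : C.face true i (C.deg i Y) = C.face false i (C.conn false i Y) := by
    rw [C.face_deg_self _ _ _ hi (by omega), C.face_conn_same _ _ _ hi (by omega)]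
  have k3 : C.face true (i + 1) (C.comp i (C.conn false i X) (C.deg (i + 1) Y)) =
      C.face false (i + 1) (C.comp i (C.deg i Y) (C.conn false i Y)) := by
    rw [C.face_comp_gt _ _ _ _ _ hi (by omega) (by omega) k1,
      C.face_comp_gt _ _ _ _ _ hi (by omega) (by omega) k2,
      C.face_deg_self _ _ _ (by omega) (by omega), C.face_conn_same_succ _ _ _ hi (by omega),
      C.face_deg_gt _ i i _ hi le_rfl (by omega), C.deg_comp_unit _ _ hi (by omega)]
    have := C.face_conn_opp_succ true i X hi (by omega)
    rw [Bool.not_true] at this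
    rw [this, h, C.deg_comp_unit _ _ hi (by omega)]
  rw [C.conn_minus_comp_self _ _ _ hi (by omega) h, T_comp_self hC (i + 1) _ _ (by omega) (by omega) k3,
    T_comp_other hC i (i + 2) _ _ hi (by omega) (by omega) (by omega) (by omega) (by omega)
      (by rw [face_T_succ hC _ (i + 1) _ (by omega) (by omega), k3,
            face_T_succ hC _ (i + 1) _ (by omega) (by omega)]),
    T_comp_other hC (i + 1) i _ _ (by omega) (by omega) hi (by omega) (by omega) (by omega) k1,
    T_comp_other hC (i + 1) i _ _ (by omega) (by omega) hi (by omega) (by omega) (by omega) k2,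
    T_comp_self hC i _ _ hi (by omega) (by rw [face_T_lt hC _ _ _ _ hi le_rfl hn, k1,
      face_T_lt hC _ _ _ _ hi le_rfl hn]),
    T_comp_self hC i _ _ hi (by omega) (by rw [face_T_lt hC _ _ _ _ hi le_rfl hn, k2,
      face_T_lt hC _ _ _ _ hi le_rfl hn]), hX, hY,
    T_deg_self hC (i + 1) Y (by omega) (by omega), T_deg_lt hC i (i + 2) Y hi (by omega) (by omega),
    T_deg_ge hC i i Y hi le_rfl hn, T_deg_self hC i _ hi (by omega), T_comp_self hC _ _ _ hi hn h,
    C.conn_minus_comp_self (i + 1) _ _ (by omega) (by omega)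
      (by rw [face_T_succ hC _ _ _ hi hn, face_T_succ hC _ _ _ hi hn, h])]

lemma T_T_conn_comp_succ {X Y : C.cell (n + 2)} (h : C.face true (i + 1) X = C.face false (i + 1) Y)
    (hX : T hC i (T hC (i + 1) (C.conn false i X)) = C.conn false (i + 1) (T hC i X))
    (hY : T hC i (T hC (i + 1) (C.conn false i Y)) = C.conn false (i + 1) (T hC i Y)) :
    T hC i (T hC (i + 1) (C.conn false i (C.comp (i + 1) X Y))) =
      C.conn false (i + 1) (T hC i (C.comp (i + 1) X Y)) := by
  have k : C.face true (i + 2) (C.conn false i X) = C.face false (i + 2) (C.conn false i Y) := by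
    rw [C.face_conn_gt _ _ (i + 1) i _ hi (by omega) (by omega), h,
      C.face_conn_gt _ _ (i + 1) i _ hi (by omega) (by omega)]
  rw [C.conn_comp_lt _ i (i + 1) _ _ hi (by omega) (by omega) h,
    T_comp_succ hC (i + 1) _ _ (by omega) (by omega) k,
    T_comp_succ hC i _ _ hi (by omega) (by rw [face_T_self hC _ (i + 1) _ (by omega) (by omega), k,
      face_T_self hC _ (i + 1) _ (by omega) (by omega)]), hX, hY, T_comp_succ hC i _ _ hi hn h,
    C.conn_comp_gt _ (i + 1) i _ _ hi (by omega) (by omega)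
      (by rw [face_T_self hC _ _ _ hi hn, face_T_self hC _ _ _ hi hn, h])]

lemma T_T_conn_deg (x : C.cell (n + 1)) :
    T hC i (T hC (i + 1) (C.conn false i (C.deg i x))) = C.conn false (i + 1) (T hC i (C.deg i x)) := by
  rw [C.conn_deg_self _ _ _ hi (by omega), T_deg_ge hC i i _ hi le_rfl hn, T_deg_self hC _ _ hi hn,
    T_deg_self hC _ _ hi (by omega), C.conn_deg_self _ _ _ (by omega) (by omega)]

lemma T_T_conn_conn_false (x : C.cell (n + 1)) :
    T hC i (T hC (i + 1) (C.conn false i (C.conn false i x))) =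
      C.conn false (i + 1) (T hC i (C.conn false i x)) := by
  rw [T_conn_self hC _ _ x hi hn, ← C.conn_conn_self _ _ _ hi hn,
    T_conn_self hC _ _ _ (by omega) (by omega), C.conn_conn_self _ _ _ hi hn,
    T_conn_self hC _ _ _ (by omega) (by omega)]

/-- Both `A` and `Γ_i^- A` are globular, hence invertible, in directions `i` and `i + 1`
respectively, so all transposes involved have closed formulas in terms of the inverses `A'` and `V`,
and these can be compared. -/
lemma T_T_conn_of_isGlobular {A : C.cell (n + 2)} (hA : IsGlobular i A) :
    T hC i (T hC (i + 1) (C.conn false i A)) = C.conn false (i + 1) (T hC i A) := by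
  obtain ⟨A', hA'⟩ := hA.isRInvertible hC hi hn
  obtain ⟨p, hp⟩ := hA false
  obtain ⟨q, hq⟩ := hA true
  have hd : ∀ α p, C.face α (i + 1) A = C.deg i p →
      C.face α (i + 2) (C.conn false i A) = C.deg (i + 1) (C.deg i p) := by
    intro α p h
    rw [C.face_conn_gt _ _ (i + 1) i _ hi (by omega) (by omega), h, C.conn_deg_self _ _ _ hi (by omega),
      C.deg_deg i i p hi le_rfl hn]
  have hG : IsGlobular (i + 1) (C.conn false i A) := by
    rintro (_ | _)
    · exact ⟨_, hd _ _ hp⟩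
    · exact ⟨_, hd _ _ hq⟩
  obtain ⟨V, hV⟩ := hG.isRInvertible hC (by omega) (by omega)
  have f1 : C.face true (i + 1) (C.conn false i A) = C.deg i (C.face true i A) :=
    C.face_conn_opp_succ true i A hi (by omega)
  have f2 : C.face false (i + 1) (C.conn false i A) = A :=
    C.face_conn_same_succ false i A hi (by omega)
  have e1 : T hC (i + 1) (C.conn false i A) = C.comp (i + 1) (C.deg i (C.conn true i (C.face true i A)))
      (C.comp (i + 1) V (C.conn false (i + 1) A)) := by
    refine ((isT_T hC (n := n + 1) (i := i + 1) (by omega) (by omega) _).eq_of_isR1_of_degenerate hV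
      (hd _ _ hp) (hd _ _ hq)).trans ?_
    change C.comp (i + 1) (C.conn true (i + 1) (C.face true (i + 1) (C.conn false i A)))
      (C.comp (i + 1) V (C.conn false (i + 1) (C.face false (i + 1) (C.conn false i A)))) = _
    rw [f1, f2, C.conn_deg_gt _ i i _ hi le_rfl hn]
  have e2 : T hC i (C.conn false (i + 1) A) =
      C.comp i (C.comp i (C.conn false i A) (C.conn true i (C.conn false i (C.face true i A))))
        (C.comp i (C.conn false (i + 1) A') (C.conn false i (C.conn false i (C.face false i A)))) := by
    have g2 : C.face true (i + 1) (C.conn false (i + 1) A) = C.deg i (C.deg i q) := by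
      refine (C.face_conn_opp true (i + 1) A (by omega) (by omega)).trans ?_
      rw [hq, C.deg_deg i i q hi le_rfl hn]
    refine ((isT_T hC (n := n + 1) (i := i) hi (by omega) _).eq_of_isR1
      (hA'.conn hi le_rfl (by omega) false) g2).trans ?_
    change C.comp i (C.comp i (C.conn false i (C.face false (i + 1) (C.conn false (i + 1) A)))
        (C.conn true i (C.face true i (C.conn false (i + 1) A))))
      (C.comp i (C.conn false (i + 1) A') (C.conn false i (C.face false i (C.conn false (i + 1) A)))) = _
    rw [C.face_conn_same _ _ _ (by omega) (by omega), C.face_conn_lt _ _ i i _ hi le_rfl hn,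
      C.face_conn_lt _ _ i i _ hi le_rfl hn]
  have e3 : T hC i A = C.comp i (C.conn true i (C.face true i A))
      (C.comp i A' (C.conn false i (C.face false i A))) :=
    (isT_T hC hi hn A).eq_of_isR1_of_degenerate hA' hp hq
  -- The unknown inverse `V` is eliminated here: after transposition it cancels the factor `Γ_i^- A`
  -- contributed by `e2`.
  have e4 : C.comp i (T hC i V) (C.conn false i A) = C.deg i (C.deg i (C.face true i A)) := by
    have := T_comp_succ hC i V (C.conn false i A) hi (by omega) hV.2.1
    rw [T_conn_self hC _ _ _ hi (by omega)] at this
    rw [← this, hV.2.2.2, f1, T_deg_succ hC _ _ hi (by omega)]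
  have hQ : C.face false i (C.conn true i (C.conn false i (C.face true i A))) =
      C.deg i (C.face true i A) := by
    refine (C.face_conn_opp false i _ hi (by omega)).trans ?_
    rw [C.face_conn_same _ _ _ hi hn]
  have hR1 : ∀ α, C.face α i (C.conn false (i + 1) A') = C.conn false i (C.face α i A') :=
    fun α => C.face_conn_lt _ _ i i _ hi le_rfl hn
  have k1 : C.face true i (T hC i V) = C.face false i (C.conn false i A) := by
    rw [face_T_self hC _ _ _ hi (by omega), hV.2.1, f2, C.face_conn_same _ _ _ hi (by omega)]
  have k2 : C.face true i (C.conn false i A) =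
      C.face false i (C.conn true i (C.conn false i (C.face true i A))) := by
    rw [hQ]
    exact C.face_conn_opp true i A hi (by omega)
  have k3 : C.face true i (C.conn true i (C.conn false i (C.face true i A))) =
      C.face false i (C.conn false (i + 1) A') := by
    rw [hR1, ← hA'.1, C.face_conn_same _ _ _ hi (by omega)]
  have k4 : C.face true i (C.conn false (i + 1) A') =
      C.face false i (C.conn false i (C.conn false i (C.face false i A))) := by
    rw [hR1, hA'.2.1, C.face_conn_same _ _ _ hi (by omega)]
  have k5 : C.face true i (C.deg (i + 1) (C.conn true i (C.face true i A))) =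
      C.face false i (C.conn true i (C.conn false i (C.face true i A))) := by
    rw [hQ, C.face_deg_lt _ _ _ _ hi le_rfl (by omega), C.face_conn_same _ _ _ hi hn]
  have k6 : C.face true i A' = C.face false i (C.conn false i (C.face false i A)) := by
    rw [hA'.2.1, C.face_conn_same _ _ _ hi hn]
  have k7 : C.face true i (C.conn true i (C.face true i A)) =
      C.face false i (C.comp i A' (C.conn false i (C.face false i A))) := by
    rw [C.face_conn_same _ _ _ hi hn, C.face_comp_minus _ _ _ hi (by omega) k6, hA'.1]
  have k8 : C.face true (i + 1) V = C.face false (i + 1) (C.conn false (i + 1) A) := by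
    rw [hV.2.1, f2, C.face_conn_same _ _ _ (by omega) (by omega)]
  have k9 : C.face true (i + 1) (C.deg i (C.conn true i (C.face true i A))) =
      C.face false (i + 1) (C.comp (i + 1) V (C.conn false (i + 1) A)) := by
    rw [C.face_comp_minus _ _ _ (by omega) (by omega) k8, ← hV.1, f1,
      C.face_deg_gt _ i i _ hi le_rfl (by omega), C.face_conn_same _ _ _ hi hn]
  have k10 : ∀ X : C.cell (n + 3), C.face true i X = C.face false i (C.conn false (i + 1) A') →
      C.face true i X = C.face false i (C.comp i (C.conn false (i + 1) A')
        (C.conn false i (C.conn false i (C.face false i A)))) := by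
    intro X h
    rw [C.face_comp_minus _ _ _ hi (by omega) k4, h]
  have k11 : C.face true i (C.comp i (C.conn false i A)
      (C.conn true i (C.conn false i (C.face true i A)))) =
      C.face false i (C.conn false (i + 1) A') := by
    rw [C.face_comp_plus _ _ _ hi (by omega) k2, k3]
  rw [e1, T_comp_succ hC _ _ _ hi (by omega) k9, T_comp_succ hC _ _ _ hi (by omega) k8,
    T_deg_self hC _ _ hi (by omega), e2,
    C.comp_assoc i (T hC i V) _ _ hi (by omega)
      (by rw [C.face_comp_minus _ _ _ hi (by omega) k2, k1]) (k10 _ k11),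
    C.comp_assoc i (T hC i V) _ _ hi (by omega) k1 k2, e4, ← hQ, C.deg_comp_unit _ _ hi (by omega),
    C.comp_assoc i _ _ _ hi (by omega) k5 (k10 _ k3), comp_deg_conn_conn hi hn, e3,
    C.conn_comp_gt _ (i + 1) i _ _ hi (by omega) (by omega) k7,
    C.conn_comp_gt _ (i + 1) i _ _ hi (by omega) (by omega) k6, C.conn_conn_self _ _ _ hi hn]

/-- The identity is stable under both compositions, so `of_psi` reduces it to degenerate cells,
connections and a folding, which is globular. -/
lemma T_T_conn_minus (A : C.cell (n + 2)) :
    T hC i (T hC (i + 1) (C.conn false i A)) = C.conn false (i + 1) (T hC i A) :=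
  ConnDouble.of_psi (D := C.slice n i hi hn)
    (fun A : C.cell (n + 2) =>
      T hC i (T hC (i + 1) (C.conn false i A)) = C.conn false (i + 1) (T hC i A))
    (fun _ _ h hX hY => T_T_conn_comp_self hC hi hn h hX hY)
    (fun _ _ h hX hY => T_T_conn_comp_succ hC hi hn h hX hY)
    (T_T_conn_of_isGlobular hC hi hn (isGlobular_psi hi hn A))
    (fun _ => T_T_conn_deg hC hi hn _)
    (fun _ β => match β with
      | false => T_T_conn_conn_false hC hi hn _
      | true => T_T_conn_conn_true hC hi hn _)

/-- For `Γ^+`, apply `T_i T_{i+1}` to `Γ_i^+ A ⋆_i Γ_i^- A = ε_{i+1} A`; with the case of `Γ^-`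
known, `eq_g_true` identifies the first factor. -/
lemma T_T_conn (α : Bool) (A : C.cell (n + 2)) :
    T hC i (T hC (i + 1) (C.conn α i A)) = C.conn α (i + 1) (T hC i A) := by
  obtain _ | _ := α
  · exact T_T_conn_minus hC hi hn A
  have hA : C.face true i (C.conn true i A) = C.face false i (C.conn false i A) := by
    rw [C.face_conn_same _ _ _ hi (by omega), C.face_conn_same _ _ _ hi (by omega)]
  refine ConnDouble.eq_g_true (D := C.slice (n + 1) (i + 1) (by omega) (by omega))
    (p := C.face false i A) ?_ ?_ ?_
  · change C.face true (i + 1) (T hC i _) = _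
    rw [face_T_succ hC _ _ _ hi (by omega), face_T_lt hC _ _ _ _ hi le_rfl hn,
      C.face_conn_same _ _ _ hi (by omega)]
  · change C.face false (i + 2) (T hC i _) = C.deg (i + 1) _
    rw [face_T_gt hC _ _ _ _ hi (by omega) (by omega), face_T_succ hC _ (i + 1) _ (by omega) (by omega),
      ← T_deg_self hC i _ hi hn]
    congr 1
    exact C.face_conn_opp_succ false i A hi (by omega)
  · change C.comp (i + 1) _ (C.conn false (i + 1) _) = C.deg (i + 2) _
    rw [← T_T_conn_minus hC hi hn,
      ← T_comp_self hC _ _ _ hi (by omega) (by rw [face_T_lt hC _ _ _ _ hi le_rfl hn, hA,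
        face_T_lt hC _ _ _ _ hi le_rfl hn]),
      ← T_comp_other hC _ _ _ _ (by omega) (by omega) hi (by omega) (by omega) (by omega) hA,
      C.conn_comp_conn _ _ hi (by omega), T_deg_self hC _ _ (by omega) (by omega),
      T_deg_lt hC _ _ _ hi (by omega) (by omega)]

lemma T_conn_T (α : Bool) (A : C.cell (n + 2)) :
    T hC (i + 1) (C.conn α i (T hC i A)) = T hC i (C.conn α (i + 1) A) := by
  have h := T_T_conn hC hi hn α (T hC i A)
  rw [T_T hC _ _ hi hn] at h
  rw [← h, T_T hC _ _ hi (by omega)]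

lemma T_conn_succ_T (α : Bool) (A : C.cell (n + 2)) :
    T hC i (C.conn α (i + 1) (T hC i A)) = T hC (i + 1) (C.conn α i A) := by
  rw [← T_T_conn hC hi hn, T_T hC _ _ hi (by omega)]

/-- The composite `T_{i+1} T_i` carries the double structure in directions `i + 1`, `i + 2` to the
one in directions `i`, `i + 1`, so it intertwines `T_{i+1}` with `T_i`. -/
lemma T_braid (A : C.cell (n + 3)) :
    T hC i (T hC (i + 1) (T hC i A)) = T hC (i + 1) (T hC i (T hC (i + 1) A)) := by
  refine T_map hC (i := i + 1) (i' := i) (by omega) (by omega) hi (by omega)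
    (fun A : C.cell (n + 3) => T hC (i + 1) (T hC i A)) (T hC i) ?_ ?_ ?_ ?_ ?_ A
  · intro β A
    rw [face_T_lt hC _ _ _ _ hi le_rfl hn, face_T_self hC _ _ _ hi (by omega)]
  · intro β A
    rw [face_T_self hC _ (i + 1) _ (by omega) (by omega),
      face_T_gt hC _ _ _ _ hi (by omega) (by omega)]
  · intro β x
    have h := T_conn_succ_T hC hi hn β (T hC i x)
    rw [T_T hC _ _ hi hn] at h
    change T hC (i + 1) (T hC i _) = _
    rw [h, T_T hC _ _ (by omega) (by omega)]
  · intro A B h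
    rw [T_comp_succ hC _ _ _ hi (by omega) h,
      T_comp_other hC _ _ _ _ (by omega) (by omega) hi (by omega) (by omega) (by omega)
        (by rw [face_T_self hC _ _ _ hi (by omega), face_T_self hC _ _ _ hi (by omega), h])]
  · intro A B h
    rw [T_comp_other hC _ _ _ _ hi (by omega) (by omega) (by omega) (by omega) (by omega) h,
      T_comp_succ hC _ _ _ (by omega) (by omega)
        (by rw [face_T_gt hC _ _ _ _ hi (by omega) (by omega), h,
          face_T_gt hC _ _ _ _ hi (by omega) (by omega)])]

end

/-- The `T_i`-inverses of a cubical `(ω, 1)`-category make it a symmetric cubical `ω`-category. -/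
noncomputable def symmetricStructure : C.SymmetricStructure where
  T := T hC
  face_T_lt α i j A hi hij hj := face_T_lt hC α i j A hi hij hj
  face_T_gt α i j A hj hij hi := face_T_gt hC α i j A hj hij hi
  face_T_self α j A hj hn := face_T_self hC α j A hj hn
  face_T_succ α j A hj hn := face_T_succ hC α j A hj hn
  T_deg_self j A hj hn := T_deg_self hC j A hj hn
  T_deg_succ j A hj hn := T_deg_succ hC j A hj hn
  T_deg_lt i j A hi hij hj := T_deg_lt hC i j A hi hij hj
  T_deg_ge i j A hj hij hi := T_deg_ge hC i j A hj hij hi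
  T_conn_self α j A hj hn := T_conn_self hC α j A hj hn
  T_conn_lt α i j A hi hij hj := T_conn_lt hC α i j A hi hij hj
  T_conn_gt α i j A hj hij hi := T_conn_gt hC α i j A hj hij hi
  T_conn_T α _ A hi hn := T_conn_T hC hi hn α A
  T_conn_succ_T α _ A hi hn := T_conn_succ_T hC hi hn α A
  T_comp_self i A B hi hn h := T_comp_self hC i A B hi hn h
  T_comp_succ i A B hi hn h := T_comp_succ hC i A B hi hn h
  T_comp_other i j A B hi hn hj hjn h1 h2 h := T_comp_other hC i j A B hi hn hj hjn h1 h2 h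
  T_T i A hi hn := T_T hC i A hi hn
  T_braid := by
    intro n i A hi hn
    obtain ⟨n, rfl⟩ : ∃ n', n = n' + 1 := ⟨n - 1, by omega⟩
    exact T_braid hC hi (by omega) A
  T_comm i j A hi hij hj := T_comm hC i j A hi hij hj

end CubicalOmegaCat

/-- In a cubical `(ω,1)`-category every cell has a unique `T_i`-inverse in each legal direction `i`,
and the resulting total maps `A ↦ T_i A` form the structure of a symmetric cubical `ω`-category. -/
theorem proposition5p1p9 (C : CubicalOmegaCat.{u}) (hC : C.IsOmegaP 1) :
    (∀ (n i : ℕ), 1 ≤ i → i ≤ n + 1 → ∀ A : C.cell (n + 2), ∃! B, C.IsTInverse i A B) ∧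
    ∃ S : C.SymmetricStructure, ∀ (n i : ℕ), 1 ≤ i → i ≤ n + 1 →
      ∀ A : C.cell (n + 2), C.IsTInverse i A (S.T i A) :=
  ⟨fun _ i hi hn A => ⟨CubicalOmegaCat.T hC i A, CubicalOmegaCat.isTInverse_T hC hi hn A,
    fun _ hB => (CubicalOmegaCat.isTInverse_T hC hi hn A).unique hi hn hB⟩,
    CubicalOmegaCat.symmetricStructure hC,
    fun _ _ hi hn A => CubicalOmegaCat.isTInverse_T hC hi hn A⟩
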